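/- Let $\omega$ be a symplectic form on $\mathbb{R}^2$ and let $B$ be a real $2\times 2$ matrix such that $\omega(B\xi,\eta)=-\omega(\xi,B\eta)$ for all $\xi,\eta\in\mathbb{R}^2$ and such that the symmetric form $\omega(B\cdot,\cdot)$ is (positive or negative) definite. The oscillator group $Osc_1(\omega,B)$ is the Lie group $\mathbb{R}\times\mathbb{R}^2\times\mathbb{R}$ with multiplication \[(z,\xi,t)(v,\eta,s)=\left(z+v+\tfrac12\omega(\xi,e^{tB}\eta),\ \xi+e^{tB}\eta,\ t+s\right).\] Let $H_1(\omega)=\mathbb{R}\times\mathbb{R}^2\times\{0\}$ be its Heisenberg subgroup and let $\Pi(z,\xi,t)=t$. A lattice is a discrete subgroup with compact quotient, and isomorphisms are isomorphisms of Lie groups (equivalently, bicontinuous group isomorphisms). For an integer $r\ge 1$ put $\omega_r(\xi,\eta)=r(\xi_1\eta_2-\xi_2\eta_1)$, and in a group $Osc_1(\omega_r,B)$ let $\Gamma_r$ be the subgroup generated by $(1,0,0),(0,e_1,0),(0,e_2,0)$. For $x\in\mathbb{R}$ and $y>0$ put \[B_{x,y}=\begin{pmatrix}\frac{x}{y}&-\frac{x^2}{y}-y\\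 \frac1y&-\frac{x}{y}\end{pmatrix},\qquad \mathbb{F}_1=\left\{(x,y)\in\mathbb{R}^2 \mid 0\le x\le\tfrac12,\ y>0,\ x^2+y^2\ge 1\right\}.\] Call $(r,\lambda,(x,y))$ admissible if $r\ge 1$ is an integer and $\lambda=\lambda_0+k\pi$ for an integer $k\ge 0$ and some $\lambda_0\in\{\frac{\pi}{3},\frac{\pi}{2},\frac{2\pi}{3},\pi\}$, where \[(x,y)\begin{cases}=(\frac12,\frac{\sqrt3}{2}),&\lambda_0\in\{\frac{\pi}{3},\frac{2\pi}{3}\},\\ =(0,1),&\lambda_0=\frac{\pi}{2},\\ \in\mathbb{F}_1,&\lambda_0=\pi.\end{cases}\] Theorem. Let $L$ be a lattice of $Osc_1(\omega,B)$. Then there is exactly one admissible triple $(r,\lambda,(x,y))$ for which there exists an isomorphism $\varphi: Osc_1(\omega,B)\to Osc_1(\omega_r,\lambda B_{x,y})$ with $\varphi(L)\cap H_1(\omega_r)=\Gamma_r$ and $\Pi(\varphi(L))=\mathbb{Z}$. Conversely, for every admissible triple $(r,\lambda,(x,y))$ there exists a lattice $L$ in $Osc_1(\omega_r,\lambda B_{x,y})$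 with $L\cap H_1(\omega_r)=\Gamma_r$ and $\Pi(L)=\mathbb{Z}$. -/

import Mathlib

open scoped Matrix

/-- The parameters `(ω, B)` of a four-dimensional oscillator group: a symplectic form `ω` on `ℝ²`
and a real `2 × 2` matrix `B` with `ω(Bξ, η) = -ω(ξ, Bη)` and `ω(B·, ·)` definite. -/
structure OscParam where
  ω : LinearMap.BilinForm ℝ (Fin 2 → ℝ)
  B : Matrix (Fin 2) (Fin 2) ℝ
  alt : ω.IsAlt
  nondeg : ω.Nondegenerate
  skew : ∀ ξ η : Fin 2 → ℝ, ω (B *ᵥ ξ) η = -ω ξ (B *ᵥ η)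
  definite : (∀ ξ : Fin 2 → ℝ, ξ ≠ 0 → 0 < ω (B *ᵥ ξ) ξ) ∨
    (∀ ξ : Fin 2 → ℝ, ξ ≠ 0 → ω (B *ᵥ ξ) ξ < 0)

namespace OscParam

/-- The one-parameter group `t ↦ e^{tB}`. -/
noncomputable def flow (P : OscParam) (t : ℝ) : Matrix (Fin 2) (Fin 2) ℝ :=
  NormedSpace.exp (t • P.B)

theorem flow_zero (P : OscParam) : P.flow 0 = 1 := by
  simp [flow]

theorem flow_add (P : OscParam) (s t : ℝ) : P.flow (s + t) = P.flow s * P.flow t := by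
  unfold flow
  rw [add_smul]
  exact Matrix.exp_add_of_commute _ _ (((Commute.refl P.B).smul_left s).smul_right t)

/-- `e^{tB}` preserves `ω`. -/
theorem ω_flow (P : OscParam) (t : ℝ) (ξ η : Fin 2 → ℝ) :
    P.ω (P.flow t *ᵥ ξ) (P.flow t *ᵥ η) = P.ω ξ η := by
  set M := LinearMap.BilinForm.toMatrix' P.ω with hM
  have hω : ∀ u v : Fin 2 → ℝ, P.ω u v = u ⬝ᵥ (M *ᵥ v) := by
    intro u v
    have h := Matrix.toBilin'_apply' M u v
    rwa [hM, Matrix.toBilin'_toMatrix'] at h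
  have hdet : IsUnit M.det := by
    rw [isUnit_iff_ne_zero]
    exact (LinearMap.BilinForm.nondegenerate_iff_det_ne_zero (Pi.basisFun ℝ (Fin 2))).1 P.nondeg
  have hU : IsUnit M := (Matrix.isUnit_iff_isUnit_det M).2 hdet
  have hskew : P.Bᵀ * M = M * (-P.B) := by
    apply Matrix.ext_of_mulVec_single
    intro j
    apply dotProduct_eq
    intro u
    have h := P.skew u (Pi.single j 1)
    rw [hω, hω] at h
    rw [dotProduct_comm, ← Matrix.mulVec_mulVec, Matrix.dotProduct_mulVec,
      Matrix.vecMul_transpose, h, dotProduct_comm _ u, ← Matrix.mulVec_mulVec, Matrix.neg_mulVec,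
      Matrix.mulVec_neg, dotProduct_neg]
  have hBt : (t • P.B)ᵀ = M * (-(t • P.B)) * M⁻¹ := by
    have h1 : P.Bᵀ = M * (-P.B) * M⁻¹ := by
      rw [← hskew, Matrix.mul_assoc, Matrix.mul_nonsing_inv _ hdet, Matrix.mul_one]
    rw [Matrix.transpose_smul, h1]
    simp
  have hflow : (P.flow t)ᵀ * M = M * NormedSpace.exp (-(t • P.B)) := by
    unfold flow
    rw [← Matrix.exp_transpose, hBt, Matrix.exp_conj _ _ hU, Matrix.mul_assoc,
      Matrix.nonsing_inv_mul _ hdet, Matrix.mul_one]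
  have hinv : NormedSpace.exp (-(t • P.B)) * P.flow t = 1 := by
    have h := P.flow_add (-t) t
    rw [neg_add_cancel, flow_zero] at h
    rw [h]
    simp [flow]
  rw [hω, hω, ← Matrix.vecMul_transpose, ← Matrix.dotProduct_mulVec, Matrix.mulVec_mulVec,
    Matrix.mulVec_mulVec, hflow, Matrix.mul_assoc, hinv, Matrix.mul_one]

end OscParam

/-- The underlying set `ℝ × ℝ² × ℝ` of the oscillator group `Osc₁(ω, B)`. -/
@[ext]
structure Osc (P : OscParam) where
  z : ℝ
  ξ : Fin 2 → ℝ
  t : ℝ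

namespace Osc

variable {P : OscParam}

/-- `(z, ξ, t)(v, η, s) = (z + v + ½ ω(ξ, e^{tB}η), ξ + e^{tB}η, t + s)`. -/
noncomputable instance : Mul (Osc P) where
  mul g h := ⟨g.z + h.z + (1 / 2 : ℝ) * P.ω g.ξ (P.flow g.t *ᵥ h.ξ),
    g.ξ + P.flow g.t *ᵥ h.ξ, g.t + h.t⟩

noncomputable instance : One (Osc P) where
  one := ⟨0, 0, 0⟩

/-- `(z, ξ, t)⁻¹ = (-z, -e^{-tB}ξ, -t)`. -/
noncomputable instance : Inv (Osc P) where
  inv g := ⟨-g.z, -(P.flow (-g.t) *ᵥ g.ξ), -g.t⟩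

@[simp] theorem mul_z (g h : Osc P) :
    (g * h).z = g.z + h.z + (1 / 2 : ℝ) * P.ω g.ξ (P.flow g.t *ᵥ h.ξ) := rfl
@[simp] theorem mul_ξ (g h : Osc P) : (g * h).ξ = g.ξ + P.flow g.t *ᵥ h.ξ := rfl
@[simp] theorem mul_t (g h : Osc P) : (g * h).t = g.t + h.t := rfl
@[simp] theorem one_z : (1 : Osc P).z = 0 := rfl
@[simp] theorem one_ξ : (1 : Osc P).ξ = 0 := rfl
@[simp] theorem one_t : (1 : Osc P).t = 0 := rfl
@[simp] theorem inv_z (g : Osc P) : g⁻¹.z = -g.z := rfl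
@[simp] theorem inv_ξ (g : Osc P) : g⁻¹.ξ = -(P.flow (-g.t) *ᵥ g.ξ) := rfl
@[simp] theorem inv_t (g : Osc P) : g⁻¹.t = -g.t := rfl

noncomputable instance : Group (Osc P) :=
  Group.ofLeftAxioms
    (by
      intro a b c
      ext i
      · simp only [mul_z, mul_ξ, mul_t, P.flow_add, Matrix.mulVec_add, map_add,
          LinearMap.add_apply, ← Matrix.mulVec_mulVec, P.ω_flow]
        ring
      · simp only [mul_ξ, mul_t, P.flow_add, Matrix.mulVec_add, ← Matrix.mulVec_mulVec, add_assoc]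
      · simp only [mul_t, add_assoc])
    (by
      intro a
      ext i <;> simp [P.flow_zero])
    (by
      intro a
      ext i
      · simp only [mul_z, inv_z, inv_ξ, inv_t, one_z, map_neg, LinearMap.neg_apply,
          P.alt.self_eq_zero]
        ring
      · simp only [mul_ξ, inv_ξ, inv_t, one_ξ, neg_add_cancel]
      · simp only [mul_t, inv_t, one_t, neg_add_cancel])

/-- The topology of `ℝ × ℝ² × ℝ`. -/
instance : TopologicalSpace (Osc P) :=
  TopologicalSpace.induced (fun g : Osc P => (g.z, g.ξ, g.t)) inferInstance

/-- The Heisenberg group `H₁(ω)`, as the subgroup `ℝ × ℝ² × {0}` of `Osc₁(ω, B)`. -/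
noncomputable def heisenberg (P : OscParam) : Subgroup (Osc P) where
  carrier := {g | g.t = 0}
  mul_mem' := by
    intro a b ha hb
    have ha' : a.t = 0 := ha
    have hb' : b.t = 0 := hb
    show a.t + b.t = 0
    rw [ha', hb', add_zero]
  one_mem' := rfl
  inv_mem' := by
    intro a ha
    have ha' : a.t = 0 := ha
    show -a.t = 0
    rw [ha', neg_zero]

/-- The subgroup `Γ_ω` generated by `(1, 0, 0)`, `(0, e₁, 0)` and `(0, e₂, 0)`. -/
noncomputable def Gam (P : OscParam) : Subgroup (Osc P) :=
  Subgroup.closure {⟨1, 0, 0⟩, ⟨0, Pi.single 0 1, 0⟩, ⟨0, Pi.single 1 1, 0⟩}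

/-- A lattice: a discrete subgroup with compact quotient. -/
def IsLattice (L : Subgroup (Osc P)) : Prop :=
  DiscreteTopology L ∧ CompactSpace (Osc P ⧸ L)

/-- `L ∩ H₁(ω) = Γ_ω`, and the projection of `L` to the last coordinate is `ℤ`. -/
def IsNormalized (L : Subgroup (Osc P)) : Prop :=
  L ⊓ heisenberg P = Gam P ∧ Osc.t '' (L : Set (Osc P)) = Set.range (fun m : ℤ => (m : ℝ))

end Osc

/-- The form `ω_r(ξ, η) = r (ξ₁ η₂ - ξ₂ η₁)` on `ℝ²`. -/
noncomputable def omegaStd (r : ℝ) : LinearMap.BilinForm ℝ (Fin 2 → ℝ) :=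
  Matrix.toBilin' !![0, r; -r, 0]

/-- The matrix `B_{x,y}`. -/
noncomputable def Bxy (x y : ℝ) : Matrix (Fin 2) (Fin 2) ℝ :=
  !![x / y, -x ^ 2 / y - y; 1 / y, -x / y]

theorem omegaStd_apply (r : ℝ) (ξ η : Fin 2 → ℝ) :
    omegaStd r ξ η = r * (ξ 0 * η 1 - ξ 1 * η 0) := by
  simp [omegaStd, Matrix.toBilin'_apply', Matrix.mulVec, dotProduct, Fin.sum_univ_two]
  ring

/-- The parameters `(ω_r, λ B_{x,y})`, for `r > 0`, `λ > 0` and `y > 0`. -/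
noncomputable def stdParam (r : ℕ) (lam x y : ℝ) (hr : 0 < r) (hlam : 0 < lam) (hy : 0 < y) :
    OscParam where
  ω := omegaStd r
  B := lam • Bxy x y
  alt := by
    intro ξ
    rw [omegaStd_apply]
    ring
  nondeg := by
    have hr' : (r : ℝ) ≠ 0 := by exact_mod_cast hr.ne'
    apply (LinearMap.BilinForm.nondegenerate_iff_det_ne_zero (Pi.basisFun ℝ (Fin 2))).2
    have h : LinearMap.BilinForm.toMatrix (Pi.basisFun ℝ (Fin 2)) (omegaStd r)
        = !![0, (r : ℝ); -r, 0] := by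
      ext i j
      rw [LinearMap.BilinForm.toMatrix_apply, omegaStd_apply]
      fin_cases i <;> fin_cases j <;> simp
    rw [h, Matrix.det_fin_two]
    simpa using hr'
  skew := by
    intro ξ η
    rw [omegaStd_apply, omegaStd_apply]
    simp [Bxy, Matrix.mulVec, dotProduct, Fin.sum_univ_two]
    ring
  definite := by
    right
    intro ξ hξ
    have hr' : (0 : ℝ) < r := by exact_mod_cast hr
    have hq : 0 < (ξ 0 - x * ξ 1) ^ 2 + y ^ 2 * (ξ 1) ^ 2 := by
      by_cases h1 : ξ 1 = 0
      · have h0 : ξ 0 ≠ 0 := by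
          intro h0
          apply hξ
          ext i
          fin_cases i
          · exact h0
          · exact h1
        rw [h1]
        simp only [mul_zero, sub_zero]
        positivity
      · positivity
    have he : omegaStd r ((lam • Bxy x y) *ᵥ ξ) ξ
        = -(r * lam / y * ((ξ 0 - x * ξ 1) ^ 2 + y ^ 2 * (ξ 1) ^ 2)) := by
      rw [omegaStd_apply]
      simp [Bxy, Matrix.mulVec, dotProduct, Fin.sum_univ_two]
      field_simp
      ring
    rw [he]
    have : 0 < r * lam / y * ((ξ 0 - x * ξ 1) ^ 2 + y ^ 2 * (ξ 1) ^ 2) := by positivity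
    linarith

/-- The half fundamental domain `𝔽₁` of the modular group. -/
def halfDomain : Set (ℝ × ℝ) :=
  {p | 0 ≤ p.1 ∧ p.1 ≤ 1 / 2 ∧ 0 < p.2 ∧ 1 ≤ p.1 ^ 2 + p.2 ^ 2}

/-- The admissible data `(r, λ, (x, y))`. -/
structure LatticeData where
  r : ℕ
  lam : ℝ
  x : ℝ
  y : ℝ
  r_pos : 0 < r
  admissible : ∃ (lam0 : ℝ) (k : ℕ), lam = lam0 + k * Real.pi ∧
    ((lam0 = Real.pi / 3 ∨ lam0 = 2 * Real.pi / 3) ∧ (x, y) = (1 / 2, Real.sqrt 3 / 2) ∨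
      lam0 = Real.pi / 2 ∧ (x, y) = (0, 1) ∨
      lam0 = Real.pi ∧ (x, y) ∈ halfDomain)

namespace LatticeData

theorem lam_pos (d : LatticeData) : 0 < d.lam := by
  obtain ⟨l, k, hl, h⟩ := d.admissible
  have hpi := Real.pi_pos
  have hk : 0 ≤ (k : ℝ) * Real.pi := by positivity
  rcases h with ⟨h | h, -⟩ | ⟨h, -⟩ | ⟨h, -⟩ <;> rw [hl, h] <;> linarith

theorem y_pos (d : LatticeData) : 0 < d.y := by
  obtain ⟨l, k, -, h⟩ := d.admissible
  rcases h with ⟨-, h⟩ | ⟨-, h⟩ | ⟨-, h⟩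
  · rw [(Prod.mk.inj h).2]
    positivity
  · rw [(Prod.mk.inj h).2]
    exact one_pos
  · exact h.2.2.1

/-- The parameters `(ω_r, λ B_{x,y})` attached to the data `(r, λ, (x, y))`. -/
noncomputable def param (d : LatticeData) : OscParam :=
  stdParam d.r d.lam d.x d.y d.r_pos d.lam_pos d.y_pos

end LatticeData

/-! Identify ℝ² with ℂ so that e^{tB} is rotation by the angle `lam * t` and ω(ξ, η) = κ Im(ξ̄η)
(`OscParam.nonempty_complexChart`). For B_{x,y} this coordinate carries ℤ² to ℤ + ℤ(-x + iy). Thus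
(x, y) records the shape of a planar lattice, λ a rotation angle, and r the commutator of the two
generators.

Normal form: the crux is that L ∩ H₁ is not abelian (`Osc.exists_ω_ne_zero`). It follows that L
meets the centre of H₁ in an infinite cyclic group, projects onto a cyclic group of times, and that
L ∩ H₁ projects to a rank-two lattice in ℂ (`Osc.IsLattice.exists_generators`). Conjugation by an
element of L over a generating time rotates this planar lattice into itself, so the crystallographic
restriction leaves only the listed angles, and forces the hexagonal or square shape unless the
rotation is ±1 (`admissible_of_rotation`). A similarity of ℂ, rescalings of z and t, and an inner
automorphism then standardize the generators.

Uniqueness: an isomorphism preserves H₁, which is the commutator subgroup, and the centre of H₁. It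
therefore induces a scaling of t and a linear map of ℝ². Matching normalized lattices makes this map
integral, and comparing periods, commutators and shortest vectors gives inequalities between the
data; the inverse isomorphism gives the reverse ones.

Converse: e^{λB} is integral of determinant one, and a suitable element over time 1 normalizes Γ_r
(`LatticeData.exists_normalizing`). -/

namespace Osc

/-! ### Coordinates and their continuity. -/

variable {P : OscParam}

/-- The defining coordinates of `Osc P` as a homeomorphism onto `ℝ × ℝ² × ℝ`. -/
def coords (P : OscParam) : Osc P ≃ₜ ℝ × (Fin 2 → ℝ) × ℝ where
  toFun g := (g.z, g.ξ, g.t)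
  invFun p := ⟨p.1, p.2.1, p.2.2⟩
  left_inv _ := rfl
  right_inv _ := rfl
  continuous_toFun := continuous_induced_dom
  continuous_invFun := continuous_induced_rng.2 continuous_id

theorem continuous_z : Continuous (fun g : Osc P => g.z) :=
  continuous_fst.comp (coords P).continuous

theorem continuous_ξ : Continuous (fun g : Osc P => g.ξ) :=
  (continuous_fst.comp continuous_snd).comp (coords P).continuous

theorem continuous_t : Continuous (fun g : Osc P => g.t) :=
  (continuous_snd.comp continuous_snd).comp (coords P).continuous

theorem continuous_mk {X : Type*} [TopologicalSpace X] {a : X → ℝ} {b : X → Fin 2 → ℝ} {c : X → ℝ}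
    (ha : Continuous a) (hb : Continuous b) (hc : Continuous c) :
    Continuous (fun x => (⟨a x, b x, c x⟩ : Osc P)) :=
  (coords P).symm.continuous.comp (ha.prodMk (hb.prodMk hc))

end Osc

/-! ### Complex coordinates in which the flow is a rotation. -/

/-- A complex coordinate on `ℝ²` in which `e^{tB}` is the rotation by the angle `lam * t`. -/
structure ComplexChart (P : OscParam) where
  C : (Fin 2 → ℝ) ≃ₗ[ℝ] ℂ
  κ : ℝ
  lam : ℝ
  κ_ne : κ ≠ 0
  lam_ne : lam ≠ 0
  flow_apply : ∀ (t : ℝ) (ξ : Fin 2 → ℝ),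
    C (P.flow t *ᵥ ξ) = Complex.exp ((lam * t : ℝ) * Complex.I) * C ξ
  ω_apply : ∀ ξ η : Fin 2 → ℝ, P.ω ξ η = κ * ((starRingEnd ℂ) (C ξ) * C η).im

theorem Bxy_mul_self {x y : ℝ} (hy : 0 < y) : Bxy x y * Bxy x y = -1 := by
  ext i j
  fin_cases i <;> fin_cases j <;> simp [Bxy, Matrix.mul_apply, Fin.sum_univ_two] <;> field_simp <;>
    ring

/-- Since `Bxy x y` squares to -1, i ↦ `Bxy x y` defines an algebra map from ℂ to matrices. It is
continuous, so it commutes with exp and transports Euler's formula. -/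
theorem exp_smul_Bxy {x y : ℝ} (hy : 0 < y) (θ : ℝ) :
    NormedSpace.exp (θ • Bxy x y) = Real.cos θ • (1 : Matrix (Fin 2) (Fin 2) ℝ)
      + Real.sin θ • Bxy x y := by
  let Φ : ℂ →ₐ[ℝ] Matrix (Fin 2) (Fin 2) ℝ := Complex.lift ⟨Bxy x y, Bxy_mul_self hy⟩
  have hΦ : ∀ w : ℂ, Φ w = w.re • (1 : Matrix (Fin 2) (Fin 2) ℝ) + w.im • Bxy x y := by
    intro w
    simp [Φ, Complex.liftAux_apply, Algebra.algebraMap_eq_smul_one]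
  have hc : Continuous Φ := Φ.toLinearMap.continuous_of_finiteDimensional
  have h1 : θ • Bxy x y = Φ ((θ : ℂ) * Complex.I) := by
    rw [hΦ]; simp
  have h2 : Φ (NormedSpace.exp ((θ : ℂ) * Complex.I))
      = NormedSpace.exp (Φ ((θ : ℂ) * Complex.I)) := by
    let _ : NormedRing (Matrix (Fin 2) (Fin 2) ℝ) := Matrix.linftyOpNormedRing
    let _ : NormedAlgebra ℝ (Matrix (Fin 2) (Fin 2) ℝ) := Matrix.linftyOpNormedAlgebra
    exact NormedSpace.map_exp Φ hc _
  rw [h1, ← h2, hΦ, ← Complex.exp_eq_exp_ℂ, Complex.exp_ofReal_mul_I_re,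
    Complex.exp_ofReal_mul_I_im]

/-- The coordinate `(ξ₀ - x ξ₁) + i y ξ₁` on `ℝ²`. -/
noncomputable def chartEquiv (x : ℝ) {y : ℝ} (hy : 0 < y) : (Fin 2 → ℝ) ≃ₗ[ℝ] ℂ where
  toFun ξ := ⟨ξ 0 - x * ξ 1, y * ξ 1⟩
  invFun w := ![w.re + x * (w.im / y), w.im / y]
  map_add' a b := by
    apply Complex.ext <;> simp <;> ring
  map_smul' a b := by
    apply Complex.ext <;> simp <;> ring
  left_inv ξ := by
    ext i
    fin_cases i <;> simp <;> field_simp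
    ring
  right_inv w := by
    apply Complex.ext <;> simp
    field_simp

@[simp] theorem chartEquiv_re (x : ℝ) {y : ℝ} (hy : 0 < y) (ξ : Fin 2 → ℝ) :
    (chartEquiv x hy ξ).re = ξ 0 - x * ξ 1 := rfl

@[simp] theorem chartEquiv_im (x : ℝ) {y : ℝ} (hy : 0 < y) (ξ : Fin 2 → ℝ) :
    (chartEquiv x hy ξ).im = y * ξ 1 := rfl

/-- The complex chart of a parameter of the form `(ω_w, lam • B_{x,y})`. -/
noncomputable def ComplexChart.ofEq {P : OscParam} {w lam x y : ℝ} (hw : w ≠ 0) (hlam : lam ≠ 0)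
    (hy : 0 < y) (hω : ∀ ξ η, P.ω ξ η = w * (ξ 0 * η 1 - ξ 1 * η 0)) (hB : P.B = lam • Bxy x y) :
    ComplexChart P where
  C := chartEquiv x hy
  κ := w / y
  lam := lam
  κ_ne := div_ne_zero hw hy.ne'
  lam_ne := hlam
  flow_apply t ξ := by
    unfold OscParam.flow
    rw [hB, smul_smul, mul_comm t lam, exp_smul_Bxy hy]
    apply Complex.ext
    · simp only [chartEquiv_re, chartEquiv_im, Complex.mul_re, Complex.exp_ofReal_mul_I_re,
        Complex.exp_ofReal_mul_I_im]
      simp [Bxy, Matrix.mulVec, dotProduct,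
        Fin.sum_univ_two]
      field_simp
      ring
    · simp only [chartEquiv_re, chartEquiv_im, Complex.mul_im, Complex.exp_ofReal_mul_I_re,
        Complex.exp_ofReal_mul_I_im]
      simp [Bxy, Matrix.mulVec, dotProduct,
        Fin.sum_univ_two]
      field_simp
      ring
  ω_apply ξ η := by
    rw [hω]
    simp only [Complex.mul_im, Complex.conj_re, Complex.conj_im, chartEquiv_re, chartEquiv_im]
    field_simp
    ring

/-- Skewness makes B trace-free and definiteness makes det B positive, so B is a multiple of a
complex structure B_{x,y}. The sign of the multiple is chosen to make y positive. -/
theorem OscParam.nonempty_complexChart (P : OscParam) : Nonempty (ComplexChart P) := by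
  have hω : ∀ ξ η, P.ω ξ η = P.ω ![1, 0] ![0, 1] * (ξ 0 * η 1 - ξ 1 * η 0) := by
    intro ξ η
    have e : ∀ v : Fin 2 → ℝ, v = v 0 • ![1, 0] + v 1 • ![0, 1] := by
      intro v
      ext i
      fin_cases i <;> simp
    have h1 := P.alt.self_eq_zero ![1, 0]
    have h2 := P.alt.self_eq_zero ![0, 1]
    have h3 := LinearMap.BilinForm.IsAlt.neg_eq P.alt ![1, 0] ![0, 1]
    rw [e ξ, e η]
    simp only [map_add, LinearMap.add_apply, map_smul, LinearMap.smul_apply, h1, h2, ← h3]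
    simp
    ring
  set w := P.ω ![1, 0] ![0, 1] with hw'
  have hBv : ∀ ξ : Fin 2 → ℝ, (P.B *ᵥ ξ) 0 = P.B 0 0 * ξ 0 + P.B 0 1 * ξ 1 ∧
      (P.B *ᵥ ξ) 1 = P.B 1 0 * ξ 0 + P.B 1 1 * ξ 1 := by
    intro ξ
    simp [Matrix.mulVec, dotProduct, Fin.sum_univ_two]
  have hf : ∀ ξ, P.ω (P.B *ᵥ ξ) ξ = w * ((P.B 0 0 * ξ 0 + P.B 0 1 * ξ 1) * ξ 1
      - (P.B 1 0 * ξ 0 + P.B 1 1 * ξ 1) * ξ 0) := by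
    intro ξ
    rw [hω, (hBv ξ).1, (hBv ξ).2]
  have hsk := P.skew ![1, 0] ![0, 1]
  rw [hω, hω, (hBv _).1, (hBv _).1, (hBv _).2, (hBv _).2] at hsk
  simp at hsk
  have hdef : ∀ ξ : Fin 2 → ℝ, ξ ≠ 0 → P.ω (P.B *ᵥ ξ) ξ ≠ 0 := by
    intro ξ h
    rcases P.definite with hd | hd
    · exact (hd ξ h).ne'
    · exact (hd ξ h).ne
  have hw : w ≠ 0 := by
    intro h
    apply hdef ![1, 0] (by intro h; simpa using congrFun h 0)
    rw [hf, h, zero_mul]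
  have htr : P.B 1 1 = -P.B 0 0 := by
    have : w * (P.B 0 0 + P.B 1 1) = 0 := by linarith
    rcases mul_eq_zero.1 this with h | h
    · exact absurd h hw
    · linarith
  have hc : P.B 1 0 ≠ 0 := by
    intro h
    apply hdef ![1, 0] (by intro h; simpa using congrFun h 0)
    rw [hf, h]
    simp
  have hdet : 0 < -(P.B 0 0) ^ 2 - P.B 0 1 * P.B 1 0 := by
    -- This vector is Be₁. As B² = -det B, ω(B·Be₁, Be₁) = det B · ω(Be₁, e₁); both are values of
    -- one definite form, so det B > 0.
    have ha : ![P.B 0 0, P.B 1 0] ≠ 0 := fun h => hc (by simpa using congrFun h 1)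
    have hb : ![(1 : ℝ), 0] ≠ 0 := by intro h; simpa using congrFun h 0
    have e1 := hf ![P.B 0 0, P.B 1 0]
    have e2 := hf ![(1 : ℝ), 0]
    simp only [Matrix.cons_val_zero, Matrix.cons_val_one] at e1 e2
    rw [htr] at e1
    have key : P.ω (P.B *ᵥ ![P.B 0 0, P.B 1 0]) ![P.B 0 0, P.B 1 0]
        = P.ω (P.B *ᵥ ![(1 : ℝ), 0]) ![(1 : ℝ), 0]
          * (-(P.B 0 0) ^ 2 - P.B 0 1 * P.B 1 0) := by
      rw [e1, e2]; ring
    rcases P.definite with hd | hd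
    · exact (pos_iff_pos_of_mul_pos (key ▸ hd _ ha)).1 (hd _ hb)
    · have h1 := hd _ ha
      have h2 := hd _ hb
      rw [key] at h1
      by_contra hcon
      push Not at hcon
      nlinarith [mul_nonneg_of_nonpos_of_nonpos h2.le hcon]
  set D := -(P.B 0 0) ^ 2 - P.B 0 1 * P.B 1 0 with hD
  have hs : Real.sqrt D ^ 2 = D := Real.sq_sqrt hdet.le
  have hs0 : 0 < Real.sqrt D := Real.sqrt_pos.2 hdet
  obtain ⟨l, hl0, hl2, hlc⟩ : ∃ l : ℝ, l ≠ 0 ∧ l ^ 2 = D ∧ 0 < l / P.B 1 0 := by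
    rcases lt_or_gt_of_ne hc with h | h
    · exact ⟨-Real.sqrt D, by simpa using hs0.ne', by simpa using hs,
        div_pos_of_neg_of_neg (by simpa using hs0) h⟩
    · exact ⟨Real.sqrt D, hs0.ne', hs, div_pos hs0 h⟩
  refine ⟨ComplexChart.ofEq (x := P.B 0 0 / P.B 1 0) hw hl0 hlc hω ?_⟩
  ext i j
  fin_cases i <;> fin_cases j <;> simp [Bxy, htr] <;> field_simp
  rw [hl2, hD]
  ring

namespace LatticeData

/-- The standard complex chart of `Osc₁(ω_r, λ B_{x,y})`. -/
noncomputable def chart (d : LatticeData) : ComplexChart d.param :=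
  ComplexChart.ofEq (w := d.r) (x := d.x) (by exact_mod_cast d.r_pos.ne') d.lam_pos.ne' d.y_pos
    (fun ξ η => omegaStd_apply d.r ξ η) rfl

theorem chart_C (d : LatticeData) : d.chart.C = chartEquiv d.x d.y_pos := rfl

theorem chart_lam (d : LatticeData) : d.chart.lam = d.lam := rfl

theorem chart_κ (d : LatticeData) : d.chart.κ = d.r / d.y := rfl

theorem param_ω (d : LatticeData) (ξ η : Fin 2 → ℝ) :
    d.param.ω ξ η = d.r * (ξ 0 * η 1 - ξ 1 * η 0) := omegaStd_apply d.r ξ η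

theorem param_flow (d : LatticeData) (t : ℝ) :
    d.param.flow t = Real.cos (d.lam * t) • (1 : Matrix (Fin 2) (Fin 2) ℝ)
      + Real.sin (d.lam * t) • Bxy d.x d.y := by
  have : d.param.B = d.lam • Bxy d.x d.y := rfl
  unfold OscParam.flow
  rw [this, smul_smul, mul_comm t, exp_smul_Bxy d.y_pos]

end LatticeData

namespace ComplexChart

variable {P : OscParam} (c : ComplexChart P)

theorem flow_eq (t : ℝ) (ξ : Fin 2 → ℝ) :
    P.flow t *ᵥ ξ = c.C.symm (Complex.exp ((c.lam * t : ℝ) * Complex.I) * c.C ξ) := by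
  rw [← c.flow_apply, LinearEquiv.symm_apply_apply]

theorem continuous_C : Continuous c.C := c.C.toLinearMap.continuous_of_finiteDimensional

theorem continuous_C_symm : Continuous c.C.symm :=
  c.C.symm.toLinearMap.continuous_of_finiteDimensional

theorem norm_flow (t : ℝ) (ξ : Fin 2 → ℝ) : ‖c.C (P.flow t *ᵥ ξ)‖ = ‖c.C ξ‖ := by
  rw [c.flow_apply, norm_mul, Complex.norm_exp_ofReal_mul_I, one_mul]

end ComplexChart

/-! ### The topological group structure. -/

namespace Osc

variable {P : OscParam}

theorem continuous_flow_apply {X : Type*} [TopologicalSpace X] {a : X → ℝ} {b : X → Fin 2 → ℝ}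
    (ha : Continuous a) (hb : Continuous b) : Continuous (fun x => P.flow (a x) *ᵥ b x) := by
  obtain ⟨c⟩ := P.nonempty_complexChart
  simp only [c.flow_eq]
  refine c.continuous_C_symm.comp (Continuous.mul ?_ (c.continuous_C.comp hb))
  fun_prop

theorem continuous_ω_apply {X : Type*} [TopologicalSpace X] {a b : X → Fin 2 → ℝ}
    (ha : Continuous a) (hb : Continuous b) : Continuous (fun x => P.ω (a x) (b x)) := by
  obtain ⟨c⟩ := P.nonempty_complexChart
  simp only [c.ω_apply]
  have h1 := c.continuous_C.comp ha
  have h2 := c.continuous_C.comp hb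
  exact continuous_const.mul (Complex.continuous_im.comp ((Complex.continuous_conj.comp h1).mul h2))

instance : T2Space (Osc P) := (coords P).symm.t2Space

instance : IsTopologicalGroup (Osc P) where
  continuous_mul := by
    have z1 := (continuous_z (P := P)).comp (continuous_fst (Y := Osc P))
    have z2 := (continuous_z (P := P)).comp (continuous_snd (X := Osc P))
    have x1 := (continuous_ξ (P := P)).comp (continuous_fst (Y := Osc P))
    have x2 := (continuous_ξ (P := P)).comp (continuous_snd (X := Osc P))
    have t1 := (continuous_t (P := P)).comp (continuous_fst (Y := Osc P))
    have t2 := (continuous_t (P := P)).comp (continuous_snd (X := Osc P))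
    have hf := continuous_flow_apply (P := P) t1 x2
    exact continuous_mk ((z1.add z2).add (continuous_const.mul (continuous_ω_apply x1 hf)))
      (x1.add hf) (t1.add t2)
  continuous_inv :=
    continuous_mk continuous_z.neg (continuous_flow_apply continuous_t.neg continuous_ξ).neg
      continuous_t.neg

end Osc

/-! ### Explicit powers and conjugates; a discreteness criterion. -/

namespace Osc

variable {P : OscParam}

/-- At t = 0 there is no rotation and ω(v, v) = 0, so s ↦ (sa, sv, 0) is a one-parameter subgroup.
-/
theorem zpow_mk (a : ℝ) (v : Fin 2 → ℝ) (n : ℤ) :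
    (⟨a, v, 0⟩ : Osc P) ^ n = ⟨n * a, (n : ℝ) • v, 0⟩ := by
  let f : Multiplicative ℝ →* Osc P :=
    { toFun := fun s => ⟨s.toAdd * a, s.toAdd • v, 0⟩
      map_one' := by ext <;> simp
      map_mul' := by
        intro s t
        ext i
        · simp [P.flow_zero, P.alt.self_eq_zero, add_mul]
        · simp [P.flow_zero, add_mul]
        · simp }
  have h := map_zpow f (Multiplicative.ofAdd (1 : ℝ)) n
  rw [← ofAdd_zsmul] at h
  have e1 : f (Multiplicative.ofAdd (1 : ℝ)) = ⟨a, v, 0⟩ := by simp [f]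
  rw [e1] at h
  rw [← h]
  simp [f]

theorem mk_mul_mk_zero (a b t : ℝ) (v w : Fin 2 → ℝ) :
    (⟨a, v, 0⟩ : Osc P) * ⟨b, w, t⟩ = ⟨a + b + 1 / 2 * P.ω v w, v + w, t⟩ := by
  ext i <;> simp [P.flow_zero]

theorem conj_mk_zero (g : Osc P) (z : ℝ) (η : Fin 2 → ℝ) :
    g * ⟨z, η, 0⟩ * g⁻¹ = ⟨z + P.ω g.ξ (P.flow g.t *ᵥ η), P.flow g.t *ᵥ η, 0⟩ := by
  rw [mul_inv_eq_iff_eq_mul, mk_mul_mk_zero]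
  have h := LinearMap.BilinForm.IsAlt.neg_eq P.alt g.ξ (P.flow g.t *ᵥ η)
  ext1
  · simp only [mul_z, ← h]
    ring
  · simp only [mul_ξ]
    exact add_comm _ _
  · simp

theorem t_zpow (g : Osc P) (n : ℤ) : (g ^ n).t = n * g.t := by
  let f : Osc P →* Multiplicative ℝ :=
    { toFun := fun g => Multiplicative.ofAdd g.t
      map_one' := rfl
      map_mul' := fun _ _ => rfl }
  have h := congrArg Multiplicative.toAdd (map_zpow f g n)
  simpa [f] using h

theorem isDiscrete_box {L : Subgroup (Osc P)} (h : ∀ g ∈ L, |g.z| < 1 → (∀ i, |g.ξ i| < 1) →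
    |g.t| < 1 → g = 1) : DiscreteTopology L := by
  apply discreteTopology_of_isOpen_singleton_one
  have hU : IsOpen {g : Osc P | |g.z| < 1 ∧ (∀ i, |g.ξ i| < 1) ∧ |g.t| < 1} := by
    have h1 : IsOpen {g : Osc P | |g.z| < 1} := isOpen_lt continuous_z.abs continuous_const
    have h2 : IsOpen {g : Osc P | |g.t| < 1} := isOpen_lt continuous_t.abs continuous_const
    have h3 : IsOpen {g : Osc P | ∀ i, |g.ξ i| < 1} := by
      simp only [Set.ofPred_forall]
      exact isOpen_iInter_of_finite fun i =>
        isOpen_lt ((continuous_apply i).comp continuous_ξ).abs continuous_const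
    exact h1.inter (h3.inter h2)
  convert hU.preimage continuous_subtype_val using 1
  ext ⟨g, hg⟩
  simp only [Set.mem_singleton_iff, Set.mem_preimage, Set.mem_ofPred_eq]
  constructor
  · intro h1
    have : g = 1 := congrArg Subtype.val h1
    subst this
    simp
  · rintro ⟨a, b, e⟩
    exact Subtype.ext (h g hg a b e)

end Osc

/-! ### Construction of a normalized lattice for every admissible triple. -/

namespace LatticeData

open Osc

variable (d : LatticeData)

/-- The term r·mn/2 is the z-coordinate of (0, e₁, 0)^m (0, e₂, 0)^n; reordering the factors costs
an integer multiple of r. -/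
theorem mem_Gam_iff (g : Osc d.param) : g ∈ Gam d.param ↔
    ∃ m n k : ℤ, g = ⟨k + d.r * (m * n) / 2, ![m, n], 0⟩ := by
  constructor
  · intro hg
    let H : Subgroup (Osc d.param) :=
      { carrier := {g | ∃ m n k : ℤ, g = ⟨k + d.r * (m * n) / 2, ![m, n], 0⟩}
        one_mem' := ⟨0, 0, 0, by ext i <;> [simp; (fin_cases i <;> simp); simp]⟩
        mul_mem' := by
          rintro _ _ ⟨m, n, k, rfl⟩ ⟨m', n', k', rfl⟩
          refine ⟨m + m', n + n', k + k' - d.r * (n * m'), ?_⟩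
          rw [mk_mul_mk_zero, param_ω]
          ext i
          · push_cast
            simp
            ring
          · fin_cases i <;> simp
          · rfl
        inv_mem' := by
          rintro _ ⟨m, n, k, rfl⟩
          refine ⟨-m, -n, -k - d.r * (m * n), ?_⟩
          ext i
          · push_cast
            simp
            ring
          · fin_cases i <;> simp [OscParam.flow_zero]
          · simp }
    have hle : Gam d.param ≤ H := by
      rw [Gam, Subgroup.closure_le]
      rintro _ (rfl | rfl | rfl)
      · exact ⟨0, 0, 1, by ext i <;> [simp; (fin_cases i <;> simp); simp]⟩
      · exact ⟨1, 0, 0, by ext i <;> [simp; (fin_cases i <;> simp); simp]⟩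
      · exact ⟨0, 1, 0, by ext i <;> [simp; (fin_cases i <;> simp); simp]⟩
    exact hle hg
  · rintro ⟨m, n, k, rfl⟩
    have h : (⟨k + d.r * (m * n) / 2, ![m, n], 0⟩ : Osc d.param)
        = ⟨1, 0, 0⟩ ^ k * (⟨0, Pi.single 0 1, 0⟩ ^ m * ⟨0, Pi.single 1 1, 0⟩ ^ n) := by
      rw [zpow_mk, zpow_mk, zpow_mk, mk_mul_mk_zero, mk_mul_mk_zero, param_ω, param_ω]
      ext i
      · simp
        ring
      · fin_cases i <;> simp
      · rfl
    rw [h]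
    refine mul_mem (zpow_mem (Subgroup.subset_closure (by simp)) _)
      (mul_mem (zpow_mem (Subgroup.subset_closure (by simp)) _)
        (zpow_mem (Subgroup.subset_closure (by simp)) _))

/-- The matrix `e^{λ B_{x,y}}` is integral and unimodular. -/
theorem exists_int_flow_one : ∃ p q s u : ℤ, p * u - q * s = 1 ∧
    ∀ ξ : Fin 2 → ℝ, d.param.flow 1 *ᵥ ξ = ![p * ξ 0 + q * ξ 1, s * ξ 0 + u * ξ 1] := by
  obtain ⟨l, k, hl, h⟩ := d.admissible
  have hflow : ∀ ξ : Fin 2 → ℝ, d.param.flow 1 *ᵥ ξ =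
      ![(-1) ^ k * ((Real.cos l + Real.sin l * (d.x / d.y)) * ξ 0
          - Real.sin l * (d.x ^ 2 / d.y + d.y) * ξ 1),
        (-1) ^ k * (Real.sin l / d.y * ξ 0 + (Real.cos l - Real.sin l * (d.x / d.y)) * ξ 1)] := by
    intro ξ
    rw [param_flow, mul_one, hl, Real.cos_add_nat_mul_pi, Real.sin_add_nat_mul_pi]
    ext i
    fin_cases i <;> simp [Bxy, Matrix.mulVec, dotProduct, Fin.sum_univ_two] <;> ring
  have hk2 : ((-1 : ℤ) ^ k) ^ 2 = 1 := by rw [← pow_mul, mul_comm, pow_mul]; simp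
  have key : ∃ p q s u : ℤ, p * u - q * s = 1 ∧
      (Real.cos l + Real.sin l * (d.x / d.y)) = p ∧ -(Real.sin l * (d.x ^ 2 / d.y + d.y)) = q ∧
      Real.sin l / d.y = s ∧ (Real.cos l - Real.sin l * (d.x / d.y)) = u := by
    have h3 : Real.sqrt 3 ^ 2 = 3 := Real.sq_sqrt (by norm_num)
    have h30 : Real.sqrt 3 ≠ 0 := by positivity
    rcases h with ⟨h | h, hxy⟩ | ⟨h, hxy⟩ | ⟨h, -⟩
    · obtain ⟨hx, hy⟩ := Prod.mk.inj hxy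
      refine ⟨1, -1, 1, 0, by norm_num, ?_⟩
      rw [h, hx, hy, Real.cos_pi_div_three, Real.sin_pi_div_three]
      refine ⟨?_, ?_, ?_, ?_⟩ <;> field_simp <;> norm_num
    · obtain ⟨hx, hy⟩ := Prod.mk.inj hxy
      have e : 2 * Real.pi / 3 = Real.pi - Real.pi / 3 := by ring
      refine ⟨0, -1, 1, -1, by norm_num, ?_⟩
      rw [h, hx, hy, e, Real.cos_pi_sub, Real.sin_pi_sub, Real.cos_pi_div_three,
        Real.sin_pi_div_three]
      refine ⟨?_, ?_, ?_, ?_⟩ <;> field_simp <;> norm_num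
    · obtain ⟨hx, hy⟩ := Prod.mk.inj hxy
      refine ⟨0, -1, 1, 0, by norm_num, ?_⟩
      rw [h, hx, hy]
      simp
    · refine ⟨-1, 0, 0, -1, by norm_num, ?_⟩
      rw [h]
      simp
  obtain ⟨p, q, s, u, hdet, hp, hq, hs, hu⟩ := key
  refine ⟨(-1) ^ k * p, (-1) ^ k * q, (-1) ^ k * s, (-1) ^ k * u, ?_, fun ξ => ?_⟩
  · linear_combination (p * u - q * s) * hk2 + hdet
  · rw [hflow, hp, hs, hu]
    push_cast
    rw [← hq]
    ext i
    fin_cases i <;> simp <;> ring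

/-- An element of `Osc₁(ω_r, λ B_{x,y})` over `1` which normalizes `Γ_r`. -/
theorem exists_normalizing : ∃ δ : Osc d.param, δ.t = 1 ∧
    ∀ g, g ∈ Gam d.param ↔ δ * g * δ⁻¹ ∈ Gam d.param := by
  obtain ⟨p, q, s, u, hdet, hA⟩ := d.exists_int_flow_one
  have hdetR : (p * u - q * s : ℝ) = 1 := by exact_mod_cast hdet
  -- Let A be the integral matrix. Conjugation adds ω(ξ₀, Aη) = ω((f, h), η) to z. Comparing mn/2
  -- with (pm+qn)(sm+un)/2 leaves the possibly half-integral term (ps m² + qu n²)/2; f and h supply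
  -- the linear terms turning it into ps m(m-1)/2 + qu n(n-1)/2, an integer.
  let f : ℝ := q * u / 2
  let h : ℝ := -(p * s) / 2
  let ξ₀ : Fin 2 → ℝ := ![p * f + q * h, s * f + u * h]
  have hev : ∀ m : ℤ, ∃ a : ℤ, (m : ℝ) * (m - 1) = 2 * a := by
    intro m
    obtain ⟨a, ha⟩ := Int.even_mul_pred_self m
    exact ⟨a, by exact_mod_cast ha.trans (two_mul a).symm⟩
  refine ⟨⟨0, ξ₀, 1⟩, rfl, fun g => ?_⟩
  by_cases hg : g.t = 0
  swap
  · constructor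
    · intro h1
      obtain ⟨m, n, k, rfl⟩ := (d.mem_Gam_iff _).1 h1
      exact absurd rfl hg
    · intro h1
      obtain ⟨m, n, k, h2⟩ := (d.mem_Gam_iff _).1 h1
      have h3 := congrArg Osc.t h2
      simp at h3
      exact absurd h3 hg
  obtain ⟨z, η, t⟩ := g
  obtain rfl : t = 0 := hg
  rw [conj_mk_zero, mem_Gam_iff, mem_Gam_iff, hA, param_ω]
  constructor
  · rintro ⟨m, n, k, hmk⟩
    obtain ⟨rfl, rfl, -⟩ := Osc.mk.inj hmk
    obtain ⟨a, ha⟩ := hev m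
    obtain ⟨b, hb⟩ := hev n
    refine ⟨p * m + q * n, s * m + u * n, k - d.r * (p * s * a + q * u * b) - d.r * (q * s * m * n),
      ?_⟩
    ext i
    · simp [ξ₀, f, h]
      linear_combination (d.r / 2 : ℝ) * (-m * n + p * s * m + q * u * n) * hdetR
        - (d.r / 2 : ℝ) * (p * s * ha + q * u * hb)
    · fin_cases i <;> simp
    · rfl
  · rintro ⟨m', n', k, hmk⟩
    obtain ⟨hz, hη, -⟩ := Osc.mk.inj hmk
    have h0 := congrFun hη 0
    have h1 := congrFun hη 1
    simp at h0 h1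
    obtain ⟨m, hm⟩ : ∃ m : ℤ, m = u * m' - q * n' := ⟨_, rfl⟩
    obtain ⟨n, hn⟩ : ∃ n : ℤ, n = -s * m' + p * n' := ⟨_, rfl⟩
    have hmR : (m : ℝ) = u * m' - q * n' := by exact_mod_cast hm
    have hnR : (n : ℝ) = -s * m' + p * n' := by exact_mod_cast hn
    have e0 : η 0 = m := by
      rw [hmR]; linear_combination u * h0 - q * h1 - η 0 * hdetR
    have e1 : η 1 = n := by
      rw [hnR]; linear_combination p * h1 - s * h0 - η 1 * hdetR
    obtain ⟨a, ha⟩ := hev m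
    obtain ⟨b, hb⟩ := hev n
    refine ⟨m, n, k + d.r * (p * s * a + q * u * b) + d.r * (q * s * m * n), ?_⟩
    rw [e0, e1] at hz h0 h1
    ext i
    · simp [ξ₀, f, h] at hz
      rw [← h0, ← h1] at hz
      push_cast
      linear_combination hz - (d.r / 2 : ℝ) * (-m * n + p * s * m + q * u * n) * hdetR
        + (d.r / 2 : ℝ) * (p * s * ha + q * u * hb)
    · fin_cases i
      · exact e0
      · exact e1
    · rfl

/-- The subgroup generated by `Γ_r` and an element over `1` normalizing it. -/
def extension (δ : Osc d.param)
    (hδ : ∀ g, g ∈ Gam d.param ↔ δ * g * δ⁻¹ ∈ Gam d.param) : Subgroup (Osc d.param) where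
  carrier := {g | ∃ m : ℤ, g * δ ^ m ∈ Gam d.param}
  one_mem' := ⟨0, by simp [one_mem]⟩
  mul_mem' := by
    rintro g h ⟨m, hm⟩ ⟨n, hn⟩
    -- The identity behind closure is ghδ^{n+m} = (gδ^m)(δ^{-m}(hδ^n)δ^m).
    have hz := zpow_mem ((Subgroup.mem_normalizer_iff (G := Osc d.param)).2 hδ) (-m)
    have h1 := ((Subgroup.mem_normalizer_iff (G := Osc d.param)).1 hz _).1 hn
    refine ⟨n + m, ?_⟩
    convert mul_mem hm h1 using 1
    group
  inv_mem' := by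
    rintro g ⟨m, hm⟩
    have hz := zpow_mem ((Subgroup.mem_normalizer_iff (G := Osc d.param)).2 hδ) m
    have h1 := ((Subgroup.mem_normalizer_iff (G := Osc d.param)).1 hz _).1 (inv_mem hm)
    refine ⟨-m, ?_⟩
    convert h1 using 1
    group

theorem exists_normalized_lattice :
    ∃ L : Subgroup (Osc d.param), IsLattice L ∧ IsNormalized L := by
  obtain ⟨δ, ht, hδ⟩ := d.exists_normalizing
  set L := d.extension δ hδ with hL
  have hmem : ∀ g, g ∈ L ↔ ∃ m : ℤ, g * δ ^ m ∈ Gam d.param := fun g => Iff.rfl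
  have ht0 : ∀ g ∈ Gam d.param, g.t = 0 := by
    intro g hg
    obtain ⟨m, n, k, rfl⟩ := (d.mem_Gam_iff _).1 hg
    rfl
  have hδL : ∀ m : ℤ, δ ^ m ∈ L := fun m => (hmem _).2 ⟨-m, by simp [one_mem]⟩
  have hΓL : Gam d.param ≤ L := fun g hg => (hmem _).2 ⟨0, by simpa using hg⟩
  have htm : ∀ (g : Osc d.param) (m : ℤ), g * δ ^ m ∈ Gam d.param → g.t = -m := by
    intro g m h
    have := ht0 _ h
    rw [mul_t, t_zpow, ht] at this
    linarith
  have h0 : ∀ g ∈ L, g.t = 0 → g ∈ Gam d.param := by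
    intro g hg h
    obtain ⟨m, hm⟩ := (hmem _).1 hg
    have := htm g m hm
    have hm0 : m = 0 := by
      have : (m : ℝ) = 0 := by linarith
      exact_mod_cast this
    simpa [hm0] using hm
  have hsmall : ∀ m : ℤ, |(m : ℝ)| < 1 → m = 0 := by
    intro m hm
    have : |m| < 1 := by exact_mod_cast hm
    exact Int.abs_lt_one_iff.1 this
  refine ⟨L, ⟨?_, ?_⟩, ?_, ?_⟩
  · apply isDiscrete_box
    intro g hg hz hξ htg
    have hg0 : g.t = 0 := by
      obtain ⟨m, hm⟩ := (hmem _).1 hg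
      have h1 := htm g m hm
      rw [h1, abs_neg] at htg
      rw [h1, hsmall m htg]
      simp
    obtain ⟨m, n, k, rfl⟩ := (d.mem_Gam_iff _).1 (h0 g hg hg0)
    have hm := hsmall m (by simpa using hξ 0)
    have hn := hsmall n (by simpa using hξ 1)
    subst hm hn
    have hk := hsmall k (by simpa using hz)
    subst hk
    ext i
    · simp
    · fin_cases i <;> simp
    · rfl
  -- Compact representatives for the cosets gL: right multiplication by a power of δ, then by Γ_r,
  -- then by a central element brings t, e^{-tB}ξ and z in turn into unit intervals. The flow enters
  -- because right translation by v moves ξ by e^{tB}v.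
  · let K : Set (ℝ × (Fin 2 → ℝ) × ℝ) := Set.Icc 0 1 ×ˢ (Set.Icc 0 1 ×ˢ Set.Icc 0 1)
    have hK : IsCompact K := isCompact_Icc.prod (isCompact_Icc.prod isCompact_Icc)
    let F : ℝ × (Fin 2 → ℝ) × ℝ → Osc d.param ⧸ L :=
      fun p => ((⟨p.1, d.param.flow p.2.2 *ᵥ p.2.1, p.2.2⟩ : Osc d.param) : Osc d.param ⧸ L)
    have hF : Continuous F := QuotientGroup.continuous_mk.comp
      (continuous_mk continuous_fst (continuous_flow_apply (by fun_prop) (by fun_prop))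
        (by fun_prop))
    refine ⟨?_⟩
    convert hK.image hF using 1
    symm
    rw [Set.eq_univ_iff_forall]
    intro q
    obtain ⟨g, rfl⟩ := QuotientGroup.mk_surjective q
    set g₁ := g * δ ^ (-⌊g.t⌋) with hg₁
    set η := d.param.flow (-g₁.t) *ᵥ g₁.ξ with hη
    let v : Fin 2 → ℝ := ![((-⌊η 0⌋ : ℤ) : ℝ), ((-⌊η 1⌋ : ℤ) : ℝ)]
    have hv : (⟨d.r * (((-⌊η 0⌋ : ℤ) : ℝ) * ((-⌊η 1⌋ : ℤ) : ℝ)) / 2, v, 0⟩ : Osc d.param)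
        ∈ Gam d.param := (d.mem_Gam_iff _).2 ⟨-⌊η 0⌋, -⌊η 1⌋, 0, by simp [v]⟩
    set γ : Osc d.param := ⟨d.r * (((-⌊η 0⌋ : ℤ) : ℝ) * ((-⌊η 1⌋ : ℤ) : ℝ)) / 2, v, 0⟩ with hγ
    set g₂ := g₁ * γ with hg₂
    have hc : (⟨((-⌊g₂.z⌋ : ℤ) : ℝ), 0, 0⟩ : Osc d.param) ∈ Gam d.param :=
      (d.mem_Gam_iff _).2 ⟨0, 0, -⌊g₂.z⌋, by ext i <;> [simp; (fin_cases i <;> simp); simp]⟩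
    set e : Osc d.param := ⟨((-⌊g₂.z⌋ : ℤ) : ℝ), 0, 0⟩ with he
    have hback : d.param.flow g₁.t *ᵥ η = g₁.ξ := by
      rw [hη, Matrix.mulVec_mulVec, ← OscParam.flow_add, add_neg_cancel, OscParam.flow_zero,
        Matrix.one_mulVec]
    have hg₁t : g₁.t = Int.fract g.t := by
      rw [hg₁, mul_t, t_zpow, ht, Int.fract]
      push_cast
      ring
    refine ⟨(Int.fract g₂.z, η + v, g₁.t), ⟨?_, ⟨?_, ?_⟩, ?_⟩, ?_⟩
    · exact ⟨Int.fract_nonneg _, (Int.fract_lt_one _).le⟩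
    · intro i
      fin_cases i <;> simp [v, Int.floor_le]
    · intro i
      fin_cases i <;> simp [v, add_comm (1 : ℝ), (Int.lt_floor_add_one _).le]
    · simp only [hg₁t]
      exact ⟨Int.fract_nonneg _, (Int.fract_lt_one _).le⟩
    · have hrep : (⟨Int.fract g₂.z, d.param.flow g₁.t *ᵥ (η + v), g₁.t⟩ : Osc d.param)
          = g * (δ ^ (-⌊g.t⌋) * γ * e) := by
        have : g * (δ ^ (-⌊g.t⌋) * γ * e) = g₂ * e := by
          rw [hg₂, hg₁]; group
        rw [this]
        ext1
        · simp [he, ← Int.self_sub_floor]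
          ring
        · simp [he, hg₂, hγ, Matrix.mulVec_add, hback]
        · simp [he, hg₂, hγ]
      show ((_ : Osc d.param) : Osc d.param ⧸ L) = _
      rw [QuotientGroup.eq]
      simp only [hrep, mul_inv_rev, inv_mul_cancel_right]
      exact mul_mem (inv_mem (hΓL hc)) (mul_mem (inv_mem (hΓL hv)) (inv_mem (hδL _)))
  · ext g
    exact ⟨fun h => h0 g h.1 h.2, fun h => ⟨hΓL h, ht0 g h⟩⟩
  · ext s
    constructor
    · rintro ⟨g, hg, rfl⟩
      obtain ⟨m, hm⟩ := (hmem _).1 hg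
      exact ⟨-m, by rw [htm g m hm]; simp⟩
    · rintro ⟨m, rfl⟩
      exact ⟨δ ^ m, hδL m, by rw [t_zpow, ht, mul_one]⟩

end LatticeData

/-! ### Discrete subgroups of ℝ and ℂ. -/

/-- Finiteness near 0 isolates 0, hence the subgroup is cyclic. The value q = 0 is allowed, for the
trivial subgroup. -/
theorem AddSubgroup.exists_generator_of_finite (H : AddSubgroup ℝ) {δ : ℝ} (hδ : 0 < δ)
    (hfin : {a : ℝ | a ∈ H ∧ |a| ≤ δ}.Finite) :
    ∃ q : ℝ, 0 ≤ q ∧ ∀ a, a ∈ H ↔ ∃ k : ℤ, a = k * q := by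
  obtain ⟨ε, hε, hd⟩ : ∃ ε : ℝ, 0 < ε ∧ Disjoint (H : Set ℝ) (Set.Ioo 0 ε) := by
    by_cases hne : {a : ℝ | a ∈ H ∧ |a| ≤ δ ∧ 0 < a}.Nonempty
    · have hf : {a : ℝ | a ∈ H ∧ |a| ≤ δ ∧ 0 < a}.Finite :=
        hfin.subset fun a ha => ⟨ha.1, ha.2.1⟩
      obtain ⟨m, hm, hmin⟩ := Set.exists_min_image _ id hf hne
      refine ⟨m, hm.2.2, Set.disjoint_left.2 fun a ha h => ?_⟩
      have h1 : a ≤ δ := h.2.le.trans ((le_abs_self m).trans hm.2.1)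
      exact absurd (hmin a ⟨ha, by rwa [abs_of_pos h.1], h.1⟩) (not_le.2 h.2)
    · refine ⟨δ, hδ, Set.disjoint_left.2 fun a ha h => hne ⟨a, ha, ?_, h.1⟩⟩
      rw [abs_of_pos h.1]
      exact h.2.le
  obtain ⟨b, hb⟩ := AddSubgroup.cyclic_of_isolated_zero hε hd
  refine ⟨|b|, abs_nonneg b, fun a => ?_⟩
  rw [hb, AddSubgroup.mem_closure_singleton]
  rcases abs_choice b with h | h <;> rw [h]
  · exact ⟨fun ⟨k, hk⟩ => ⟨k, by rw [← hk, zsmul_eq_mul]⟩, fun ⟨k, hk⟩ => ⟨k, by rw [hk, zsmul_eq_mul]⟩⟩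
  · exact ⟨fun ⟨k, hk⟩ => ⟨-k, by rw [← hk, zsmul_eq_mul]; push_cast; ring⟩,
      fun ⟨k, hk⟩ => ⟨-k, by rw [hk, zsmul_eq_mul]; push_cast; ring⟩⟩

/-- A discrete subgroup of rank two of `ℂ` has a basis `a, b` such that `b / a` is reduced. -/
theorem AddSubgroup.exists_reduced_basis (Λ : AddSubgroup ℂ)
    (hfin : ∀ R : ℝ, {w : ℂ | w ∈ Λ ∧ ‖w‖ ≤ R}.Finite)
    (hind : ∃ u ∈ Λ, ∃ v ∈ Λ, ((starRingEnd ℂ) u * v).im ≠ 0) :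
    ∃ a ∈ Λ, ∃ b ∈ Λ, a ≠ 0 ∧ (∀ w ∈ Λ, ∃ m n : ℤ, w = m * a + n * b) ∧
      (b / a).im ≠ 0 ∧ -(1 / 2) ≤ (b / a).re ∧ (b / a).re ≤ 0 ∧ 1 ≤ Complex.normSq (b / a) := by
  have hmin : ∀ S : Set ℂ, S ⊆ Λ → S.Nonempty → ∃ s ∈ S, ∀ w ∈ S, ‖s‖ ≤ ‖w‖ := by
    rintro S hS ⟨s₀, hs₀⟩
    have hf : {w : ℂ | w ∈ S ∧ ‖w‖ ≤ ‖s₀‖}.Finite :=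
      (hfin ‖s₀‖).subset fun w hw => ⟨hS hw.1, hw.2⟩
    obtain ⟨s, hs, h⟩ := Set.exists_min_image _ (fun w => ‖w‖) hf ⟨s₀, hs₀, le_rfl⟩
    refine ⟨s, hs.1, fun w hw => ?_⟩
    by_cases hw' : ‖w‖ ≤ ‖s₀‖
    · exact h w ⟨hw, hw'⟩
    · exact hs.2.trans (not_le.1 hw').le
  obtain ⟨u, hu, v, hv, huv⟩ := hind
  have hu0 : u ≠ 0 := by
    rintro rfl
    simp at huv
  -- Lagrange reduction: a is a shortest nonzero vector, and b below a shortest vector off the line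
  -- ℝa.
  obtain ⟨a, ⟨haΛ, ha0⟩, hamin⟩ := hmin {w | w ∈ Λ ∧ w ≠ 0} (fun w hw => hw.1) ⟨u, hu, hu0⟩
  have hne : {w : ℂ | w ∈ Λ ∧ (w / a).im ≠ 0}.Nonempty := by
    by_contra hcon
    have hre : ∀ w ∈ Λ, ∃ r : ℝ, w = r * a := by
      intro w hw
      have : (w / a).im = 0 := by
        by_contra h
        exact hcon ⟨w, hw, h⟩
      refine ⟨(w / a).re, ?_⟩
      rw [← Complex.re_add_im (w / a)]
      have h2 : ((w / a).re : ℂ) = w / a := by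
        apply Complex.ext <;> simp [this]
      simp only [this, Complex.ofReal_zero, zero_mul, add_zero, Complex.ofReal_re]
      rw [h2, div_mul_cancel₀ _ ha0]
    obtain ⟨r, rfl⟩ := hre u hu
    obtain ⟨s, rfl⟩ := hre v hv
    apply huv
    simp
    ring
  obtain ⟨b, ⟨hbΛ, hbim⟩, hbmin⟩ := hmin _ (fun w hw => hw.1) hne
  have hsq : ∀ {w w' : ℂ}, ‖w‖ ≤ ‖w'‖ → Complex.normSq (w / a) ≤ Complex.normSq (w' / a) := by
    intro w w' h
    rw [Complex.normSq_eq_norm_sq, Complex.normSq_eq_norm_sq, norm_div, norm_div]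
    gcongr
  have haa : Complex.normSq (a / a) = 1 := by rw [div_self ha0]; simp
  have hb0 : b ≠ 0 := by
    rintro rfl
    simp at hbim
  have hτ : 1 ≤ Complex.normSq (b / a) := haa ▸ hsq (hamin b ⟨hbΛ, hb0⟩)
  have hplus : Complex.normSq (b / a) ≤ Complex.normSq (b / a + 1) := by
    have := hsq (hbmin (b + a) ⟨add_mem hbΛ haΛ, by rw [add_div, div_self ha0]; simpa using hbim⟩)
    rwa [add_div, div_self ha0] at this
  have hminus : Complex.normSq (b / a) ≤ Complex.normSq (b / a - 1) := by
    have := hsq (hbmin (b - a) ⟨sub_mem hbΛ haΛ, by rw [sub_div, div_self ha0]; simpa using hbim⟩)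
    rwa [sub_div, div_self ha0] at this
  have hgen : ∀ w ∈ Λ, ∃ m n : ℤ, w = m * a + n * b := by
    intro w hw
    set τ := b / a with hτdef
    set t := (w / a).im / τ.im with ht
    set s := (w / a).re - t * τ.re with hs
    have hwa : w / a = s + t * τ := by
      apply Complex.ext
      · simp [hs]
      · simp [ht, hbim]
    -- The remainder w' has coefficients at most 1/2 in absolute value. If t' = 0 then |w'/a|² ≤ 1/4
    -- < 1; otherwise |w'/a|² ≤ 1/2 + |τ|²/4 < |τ|². Minimality of a, respectively b, forces w' = 0.
    refine ⟨round s, round t, ?_⟩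
    set w' := w - round s * a - round t * b with hw'
    have hw'Λ : w' ∈ Λ := by
      refine sub_mem (sub_mem hw ?_) ?_
      · rw [← zsmul_eq_mul]; exact zsmul_mem haΛ _
      · rw [← zsmul_eq_mul]; exact zsmul_mem hbΛ _
    have hs' := abs_sub_round s
    have ht' := abs_sub_round t
    set s' := s - round s with hs'def
    set t' := t - round t with ht'def
    have hw'a : w' / a = s' + t' * τ := by
      have : w' / a = w / a - round s - round t * τ := by
        rw [hw', hτdef]
        field_simp
      rw [this, hwa, hs'def, ht'def]
      push_cast
      ring
    have hN : Complex.normSq (w' / a) = s' ^ 2 + 2 * s' * t' * τ.re + t' ^ 2 * Complex.normSq τ := by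
      rw [hw'a, Complex.normSq_apply, Complex.normSq_apply]
      simp
      ring
    have him : (w' / a).im = t' * τ.im := by
      rw [hw'a]
      simp
    have hw'0 : w' = 0 := by
      rw [abs_le] at hs' ht'
      by_cases ht0 : t' = 0
      · by_contra hne0
        have h1 := hsq (hamin w' ⟨hw'Λ, hne0⟩)
        rw [haa, hN, ht0] at h1
        nlinarith
      · exfalso
        have h1 := hsq (hbmin w' ⟨hw'Λ, by rw [him]; exact mul_ne_zero ht0 hbim⟩)
        rw [hN] at h1
        have hs2 : s' ^ 2 ≤ 1 / 4 := by nlinarith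
        have ht2 : t' ^ 2 ≤ 1 / 4 := by nlinarith
        have hre2 : τ.re ^ 2 ≤ 1 / 4 := by
          rw [Complex.normSq_apply, Complex.normSq_apply] at hplus hminus
          simp at hplus hminus
          nlinarith
        have hst : (s' * t') ^ 2 ≤ 1 / 16 := by
          rw [mul_pow]
          nlinarith [sq_nonneg s', sq_nonneg t']
        have hst' : 2 * s' * t' * τ.re ≤ 1 / 4 := by
          nlinarith [sq_nonneg (s' * t' - τ.re / 2)]
        nlinarith
    have : w = w' + (round s * a + round t * b) := by rw [hw']; ring
    rw [this, hw'0, zero_add]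
  have hre : |(b / a).re| ≤ 1 / 2 := by
    rw [Complex.normSq_apply, Complex.normSq_apply] at hplus hminus
    simp at hplus hminus
    rw [abs_le]
    constructor <;> linarith
  rw [abs_le] at hre
  rcases le_total (b / a).re 0 with h | h
  · exact ⟨a, haΛ, b, hbΛ, ha0, hgen, hbim, hre.1, h, hτ⟩
  -- Only the sign of the real part is normalized by b ↦ -b; the imaginary part is left with either
  -- sign.
  · refine ⟨a, haΛ, -b, neg_mem hbΛ, ha0, fun w hw => ?_, ?_⟩
    · obtain ⟨m, n, hmn⟩ := hgen w hw
      exact ⟨m, -n, by rw [hmn]; push_cast; ring⟩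
    · rw [neg_div]
      simp only [Complex.neg_im, Complex.neg_re, Complex.normSq_neg]
      exact ⟨neg_ne_zero.2 hbim, by linarith, by linarith, hτ⟩

/-! ### Discreteness and cocompactness; the Heisenberg part is not abelian. -/

namespace Osc

variable {P : OscParam}

theorem finite_inter_box (c : ComplexChart P) {L : Subgroup (Osc P)} (hL : DiscreteTopology L)
    (R : ℝ) : {g : Osc P | g ∈ L ∧ |g.z| ≤ R ∧ ‖c.C g.ξ‖ ≤ R ∧ |g.t| ≤ R}.Finite := by
  let F : ℝ × ℂ × ℝ → Osc P := fun p => ⟨p.1, c.C.symm p.2.1, p.2.2⟩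
  have hF : Continuous F := continuous_mk continuous_fst
    (c.continuous_C_symm.comp (by fun_prop)) (by fun_prop)
  have hK : IsCompact (F '' (Metric.closedBall 0 R ×ˢ (Metric.closedBall 0 R ×ˢ
      Metric.closedBall 0 R))) :=
    ((isCompact_closedBall _ _).prod ((isCompact_closedBall _ _).prod
      (isCompact_closedBall _ _))).image hF
  have hcl : IsClosed (L : Set (Osc P)) := Subgroup.isClosed_of_discrete
  have hfin : (F '' (Metric.closedBall 0 R ×ˢ (Metric.closedBall 0 R ×ˢ
      Metric.closedBall 0 R)) ∩ (L : Set (Osc P))).Finite :=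
    (hK.inter_right hcl).finite (IsDiscrete.mono ⟨hL⟩ Set.inter_subset_right)
  refine hfin.subset ?_
  rintro g ⟨hg, hz, hξ, ht⟩
  refine ⟨⟨(g.z, c.C g.ξ, g.t), ⟨?_, ?_, ?_⟩, ?_⟩, hg⟩
  · simpa using hz
  · simpa using hξ
  · simpa using ht
  · simp [F]

/-- An exhaustion by open boxes covers the compact quotient at a finite stage. Inversion turns the
cosets gL into left translates and preserves the box, the flow being isometric in the chart. -/
theorem exists_mul_mem_box (c : ComplexChart P) {L : Subgroup (Osc P)}
    (hL : CompactSpace (Osc P ⧸ L)) :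
    ∃ R : ℝ, ∀ g : Osc P, ∃ l ∈ L, |(l * g).z| ≤ R ∧ ‖c.C (l * g).ξ‖ ≤ R ∧ |(l * g).t| ≤ R := by
  let U : ℕ → Set (Osc P) := fun n => {g | |g.z| < n ∧ ‖c.C g.ξ‖ < n ∧ |g.t| < n}
  have hU : ∀ n, IsOpen (U n) := fun n =>
    (isOpen_lt continuous_z.abs continuous_const).inter
      ((isOpen_lt (c.continuous_C.comp continuous_ξ).norm continuous_const).inter
        (isOpen_lt continuous_t.abs continuous_const))
  let V : ℕ → Set (Osc P ⧸ L) := fun n => (QuotientGroup.mk : Osc P → Osc P ⧸ L) '' U n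
  have hV : ∀ n, IsOpen (V n) := fun n => QuotientGroup.isOpenMap_coe _ (hU n)
  have hUmono : ∀ m n : ℕ, m ≤ n → U m ⊆ U n := by
    intro m n hmn g hg
    have h : (m : ℝ) ≤ n := by exact_mod_cast hmn
    exact ⟨hg.1.trans_le h, hg.2.1.trans_le h, hg.2.2.trans_le h⟩
  have hcover : (Set.univ : Set (Osc P ⧸ L)) ⊆ ⋃ n, V n := by
    intro q _
    obtain ⟨g, rfl⟩ := QuotientGroup.mk_surjective q
    obtain ⟨n, hn⟩ := exists_nat_gt (max |g.z| (max ‖c.C g.ξ‖ |g.t|))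
    rw [max_lt_iff, max_lt_iff] at hn
    exact Set.mem_iUnion.2 ⟨n, g, hn, rfl⟩
  obtain ⟨n, hn⟩ := isCompact_univ.elim_directed_cover V hV hcover
    (directed_of_isDirected_le fun m n hmn => Set.image_mono (hUmono m n hmn))
  refine ⟨n, fun g => ?_⟩
  obtain ⟨u, hu, hug⟩ := hn (Set.mem_univ ((g⁻¹ : Osc P) : Osc P ⧸ L))
  rw [QuotientGroup.eq] at hug
  refine ⟨u⁻¹ * g⁻¹, hug, ?_⟩
  rw [inv_mul_cancel_right]
  refine ⟨?_, ?_, ?_⟩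
  · simpa using hu.1.le
  · rw [inv_ξ, map_neg, norm_neg, c.norm_flow]
    exact hu.2.1.le
  · simpa using hu.2.2.le

theorem ω_ξ_eq_of_t_eq {L : Subgroup (Osc P)} {u : Fin 2 → ℝ}
    (h : ∀ n ∈ L, n.t = 0 → P.ω u n.ξ = 0) {g g' : Osc P} (hg : g ∈ L) (hg' : g' ∈ L)
    (ht : g.t = g'.t) : P.ω u g.ξ = P.ω u g'.ξ := by
  have h1 := h (g * g'⁻¹) (mul_mem hg (inv_mem hg')) (by simp [ht])
  have h2 : g = g * g'⁻¹ * g' := by group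
  have h3 : (g * g'⁻¹).t = 0 := by simp [ht]
  rw [h2, mul_ξ, h3, P.flow_zero, Matrix.one_mulVec, map_add, h1, zero_add]

/-- The Heisenberg part of a lattice is not abelian. -/
theorem exists_ω_ne_zero {L : Subgroup (Osc P)}
    (hL : CompactSpace (Osc P ⧸ L)) :
    ∃ α ∈ L, ∃ β ∈ L, α.t = 0 ∧ β.t = 0 ∧ P.ω α.ξ β.ξ ≠ 0 := by
  obtain ⟨c⟩ := P.nonempty_complexChart
  obtain ⟨R, hR⟩ := exists_mul_mem_box c hL
  by_contra hcon
  push Not at hcon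
  -- If every element of L acts on ℝ² by ±1, choose u ≠ 0 orthogonal to L ∩ H₁. Then ω(u, ·) on L
  -- depends only on t, and t takes finitely many values in a bounded window.
  by_cases hsin : ∀ l ∈ L, Real.sin (c.lam * l.t) = 0
  · obtain ⟨u, hu0, hu⟩ : ∃ u : Fin 2 → ℝ, u ≠ 0 ∧ ∀ n ∈ L, n.t = 0 → P.ω u n.ξ = 0 := by
      by_cases h : ∃ α ∈ L, α.t = 0 ∧ α.ξ ≠ 0
      · obtain ⟨α, hα, h0, hne⟩ := h
        exact ⟨α.ξ, hne, fun n hn hn0 => hcon α hα n hn h0 hn0⟩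
      · push Not at h
        refine ⟨Pi.single 0 1, by simp, fun n hn hn0 => ?_⟩
        rw [h n hn hn0, map_zero]
    let A : Set (Osc P) := {g | g ∈ L ∧ |g.t| ≤ R}
    have hfin : ((fun g : Osc P => P.ω u g.ξ) '' A).Finite := by
      have h1 : ((fun g : Osc P => (P.ω u g.ξ, g.t)) '' A).Finite := by
        refine Set.Finite.of_finite_image (f := Prod.snd) ?_ ?_
        · have hk : ((fun k : ℤ => k * Real.pi / c.lam) ''
              {k : ℤ | |k| ≤ ⌈|c.lam| * R / Real.pi⌉}).Finite := by
            apply Set.Finite.image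
            refine (Set.finite_Icc (-⌈|c.lam| * R / Real.pi⌉) ⌈|c.lam| * R / Real.pi⌉).subset ?_
            intro k hk
            exact abs_le.1 hk
          refine hk.subset ?_
          rintro _ ⟨_, ⟨g, ⟨hg, hgt⟩, rfl⟩, rfl⟩
          obtain ⟨k, hk⟩ := Real.sin_eq_zero_iff.1 (hsin g hg)
          refine ⟨k, ?_, ?_⟩
          · have h3 : (|k| : ℝ) * Real.pi ≤ |c.lam| * R := by
              have : |(k : ℝ)| * Real.pi = |c.lam| * |g.t| := by
                rw [← abs_mul, ← hk, abs_mul, abs_of_pos Real.pi_pos]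
              rw [this]
              gcongr
            have h4 : (|k| : ℝ) ≤ |c.lam| * R / Real.pi := by
              rwa [le_div_iff₀ Real.pi_pos]
            have h5 : ((|k| : ℤ) : ℝ) ≤ (⌈|c.lam| * R / Real.pi⌉ : ℤ) := by
              push_cast
              exact h4.trans (Int.le_ceil _)
            exact_mod_cast h5
          · have := c.lam_ne
            simp only
            rw [hk]
            field_simp
        · rintro _ ⟨g, ⟨hg, -⟩, rfl⟩ _ ⟨g', ⟨hg', -⟩, rfl⟩ h
          exact Prod.ext (ω_ξ_eq_of_t_eq hu hg hg' h) h
      have := h1.image Prod.fst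
      rwa [Set.image_image] at this
    obtain ⟨M, hM⟩ := (hfin.image (fun s => |s|)).bddAbove
    have hM' : ∀ g ∈ L, |g.t| ≤ R → |P.ω u g.ξ| ≤ M := fun g hg hgt =>
      hM ⟨_, ⟨g, ⟨hg, hgt⟩, rfl⟩, rfl⟩
    obtain ⟨w, hw⟩ : ∃ w, P.ω u w ≠ 0 := by
      refine ⟨c.C.symm (Complex.I * c.C u), ?_⟩
      rw [c.ω_apply, LinearEquiv.apply_symm_apply]
      have h1 : ((starRingEnd ℂ) (c.C u) * (Complex.I * c.C u)).im = Complex.normSq (c.C u) := by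
        rw [Complex.normSq_apply]
        simp
      rw [h1]
      refine mul_ne_zero c.κ_ne (Complex.normSq_eq_zero.not.2 ?_)
      simpa using hu0
    have hbd : ∀ ξ, |P.ω u ξ| ≤ |c.κ| * (‖c.C u‖ * ‖c.C ξ‖) := by
      intro ξ
      rw [c.ω_apply, abs_mul]
      gcongr
      refine (Complex.abs_im_le_norm _).trans ?_
      rw [norm_mul, Complex.norm_conj]
    set M' := |c.κ| * (‖c.C u‖ * R) with hM'def
    -- A point on which ω(u, ·) equals |M + M'| + 1. The action by ±1 keeps this size, so the bound
    -- M on L and the bound M' on the box cannot both hold.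
    obtain ⟨l, hl, -, hlξ, hlt⟩ := hR ⟨0, ((|M + M'| + 1) / P.ω u w) • w, 0⟩
    have hlt' : |l.t| ≤ R := by simpa using hlt
    have h1 := hM' l hl hlt'
    have h2 : |P.ω u (l * ⟨0, ((|M + M'| + 1) / P.ω u w) • w, 0⟩ : Osc P).ξ| ≤ M' :=
      (hbd _).trans (by rw [hM'def]; gcongr)
    have hflow : ∀ ξ, P.flow l.t *ᵥ ξ = Real.cos (c.lam * l.t) • ξ := by
      intro ξ
      apply c.C.injective
      rw [c.flow_apply, map_smul, Complex.exp_mul_I, ← Complex.ofReal_cos, ← Complex.ofReal_sin,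
        hsin l hl]
      simp
    have hcos : |Real.cos (c.lam * l.t)| = 1 := by
      have := Real.sin_sq_add_cos_sq (c.lam * l.t)
      rw [hsin l hl] at this
      rw [← sq_eq_sq₀ (abs_nonneg _) zero_le_one, sq_abs]
      linarith
    rw [mul_ξ, map_add] at h2
    simp only at h2
    rw [hflow, map_smul, map_smul, smul_eq_mul, smul_eq_mul, div_mul_cancel₀ _ hw] at h2
    have h3 : |Real.cos (c.lam * l.t) * (|M + M'| + 1)| = |M + M'| + 1 := by
      rw [abs_mul, hcos, one_mul, abs_of_pos (by positivity)]
    have h4 := abs_sub (P.ω u l.ξ + Real.cos (c.lam * l.t) * (|M + M'| + 1)) (P.ω u l.ξ)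
    rw [add_sub_cancel_left, h3] at h4
    linarith [le_abs_self (M + M')]
  -- Otherwise some l₀ rotates by an angle outside πℤ. For n in L ∩ H₁, commuting with its conjugate
  -- by l₀ means κ sin(θ)|n|² = 0, so n has no ξ-part. Hence each l in L commutes with l₀ up to z,
  -- which bounds its ξ-part and contradicts cocompactness.
  · push Not at hsin
    obtain ⟨l₀, hl₀, hs⟩ := hsin
    have hN : ∀ n ∈ L, n.t = 0 → n.ξ = 0 := by
      intro n hn hnt
      have hcj : (l₀ * n * l₀⁻¹).ξ = P.flow l₀.t *ᵥ n.ξ := by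
        have := conj_mk_zero l₀ n.z n.ξ
        have h2 : (⟨n.z, n.ξ, 0⟩ : Osc P) = n := by rw [← hnt]
        rw [h2] at this
        rw [this]
      have h1 := hcon n hn _ (mul_mem (mul_mem hl₀ hn) (inv_mem hl₀)) hnt (by simp [hnt])
      rw [hcj, c.ω_apply, c.flow_apply] at h1
      have h2 : ((starRingEnd ℂ) (c.C n.ξ) * (Complex.exp ((c.lam * l₀.t : ℝ) * Complex.I)
          * c.C n.ξ)).im = Real.sin (c.lam * l₀.t) * Complex.normSq (c.C n.ξ) := by
        rw [mul_left_comm, mul_comm ((starRingEnd ℂ) _), Complex.mul_conj, Complex.im_mul_ofReal,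
          Complex.exp_ofReal_mul_I_im]
      rw [h2] at h1
      have h3 : Complex.normSq (c.C n.ξ) = 0 := by
        rcases mul_eq_zero.1 h1 with h | h
        · exact absurd h c.κ_ne
        · rcases mul_eq_zero.1 h with h | h
          · exact absurd h hs
          · exact h
      simpa using h3
    set e₀ := Complex.exp ((c.lam * l₀.t : ℝ) * Complex.I) with he₀
    have he₀1 : 1 - e₀ ≠ 0 := by
      intro h
      apply hs
      have := congrArg Complex.im h
      rw [Complex.sub_im, he₀, Complex.exp_ofReal_mul_I_im] at this
      simpa using this
    have hbound : ∀ l ∈ L, ‖c.C l.ξ‖ ≤ ‖c.C l₀.ξ‖ * 2 / ‖1 - e₀‖ := by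
      intro l hl
      have h1 := hN (l * l₀ * (l₀ * l)⁻¹) (mul_mem (mul_mem hl hl₀) (inv_mem (mul_mem hl₀ hl)))
        (by simp; ring)
      have h2 : l * l₀ = l * l₀ * (l₀ * l)⁻¹ * (l₀ * l) := by group
      have h3 : (l * l₀ * (l₀ * l)⁻¹).t = 0 := by simp; ring
      have h4 : (l * l₀).ξ = (l₀ * l).ξ := by
        rw [h2, mul_ξ, h3, h1, P.flow_zero, Matrix.one_mulVec, zero_add]
      have h5 := congrArg c.C h4
      rw [mul_ξ, mul_ξ, map_add, map_add, c.flow_apply, c.flow_apply, ← he₀] at h5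
      set e := Complex.exp ((c.lam * l.t : ℝ) * Complex.I) with he
      have h6 : c.C l.ξ * (1 - e₀) = c.C l₀.ξ * (1 - e) := by linear_combination h5
      rw [le_div_iff₀ (norm_pos_iff.2 he₀1), ← norm_mul, h6, norm_mul]
      gcongr
      refine (norm_sub_le _ _).trans ?_
      rw [he, Complex.norm_exp_ofReal_mul_I]
      norm_num
    set M := ‖c.C l₀.ξ‖ * 2 / ‖1 - e₀‖ with hM
    obtain ⟨l, hl, -, hlξ, -⟩ := hR ⟨0, c.C.symm ((|R + M| + 1 : ℝ) : ℂ), 0⟩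
    rw [mul_ξ, map_add] at hlξ
    have h1 := norm_sub_le (c.C l.ξ + c.C (P.flow l.t *ᵥ c.C.symm ((|R + M| + 1 : ℝ) : ℂ)))
      (c.C l.ξ)
    rw [add_sub_cancel_left, c.norm_flow, LinearEquiv.apply_symm_apply, Complex.norm_real,
      Real.norm_of_nonneg (by positivity)] at h1
    have h2 := hbound l hl
    simp only at hlξ
    linarith [le_abs_self (R + M)]

end Osc

/-! ### Model isomorphisms and generators of a lattice. -/

namespace Osc

variable {P Q : OscParam}

/-- Conjugation by an element, as an automorphism of the topological group `Osc P`. -/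
noncomputable def conjEquiv (h : Osc P) : Osc P ≃ₜ* Osc P where
  toMulEquiv := MulAut.conj h
  continuous_toFun := by
    show Continuous fun g : Osc P => h * g * h⁻¹
    fun_prop
  continuous_invFun := by
    show Continuous fun g : Osc P => h⁻¹ * g * h
    fun_prop

theorem conjEquiv_apply (h g : Osc P) : conjEquiv h g = h * g * h⁻¹ := rfl

/-- The isomorphism `(z, ξ, t) ↦ (μ z, S ξ, c t)`. -/
noncomputable def linearIso (S : (Fin 2 → ℝ) ≃ₗ[ℝ] (Fin 2 → ℝ)) {μ c : ℝ} (hμ : μ ≠ 0) (hc : c ≠ 0)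
    (hω : ∀ ξ η, Q.ω (S ξ) (S η) = μ * P.ω ξ η)
    (hflow : ∀ t ξ, S (P.flow t *ᵥ ξ) = Q.flow (c * t) *ᵥ S ξ) : Osc P ≃ₜ* Osc Q where
  toFun g := ⟨μ * g.z, S g.ξ, c * g.t⟩
  invFun g := ⟨μ⁻¹ * g.z, S.symm g.ξ, c⁻¹ * g.t⟩
  left_inv g := by ext1 <;> simp [hμ, hc]
  right_inv g := by ext1 <;> simp [hμ, hc]
  map_mul' g h := by
    ext1
    · simp only [mul_z, ← hflow, hω]
      ring
    · simp only [mul_ξ, map_add, hflow]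
    · simp only [mul_t, mul_add]
  continuous_toFun := continuous_mk (continuous_const.mul continuous_z)
    (S.toLinearMap.continuous_of_finiteDimensional.comp continuous_ξ)
    (continuous_const.mul continuous_t)
  continuous_invFun := continuous_mk (continuous_const.mul continuous_z)
    (S.symm.toLinearMap.continuous_of_finiteDimensional.comp continuous_ξ)
    (continuous_const.mul continuous_t)

/-- Reduces normalization to the images of three generators and the scaling of t; s may be negative,
which allows time reversal. -/
theorem isNormalized_map {L : Subgroup (Osc P)} (φ : Osc P ≃ₜ* Osc Q) {α β γ : Osc P} {s : ℝ}
    (hs : s ≠ 0) (hα : α ∈ L) (hβ : β ∈ L) (hγ : γ ∈ L) (hφα : φ α = ⟨0, Pi.single 0 1, 0⟩)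
    (hφβ : φ β = ⟨0, Pi.single 1 1, 0⟩) (hφγ : φ γ = ⟨1, 0, 0⟩) (ht : ∀ g, (φ g).t = g.t / s)
    (hgen : ∀ g ∈ L, g.t = 0 → ∃ k m n : ℤ, g = γ ^ k * (α ^ m * β ^ n))
    (hT : ∀ a : ℝ, (∃ g ∈ L, g.t = a) ↔ ∃ k : ℤ, a = k * s) :
    IsNormalized (L.map (φ.toMulEquiv : Osc P →* Osc Q)) := by
  have hcoe : ∀ g, (φ.toMulEquiv : Osc P →* Osc Q) g = φ g := fun g => rfl
  constructor
  · apply le_antisymm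
    · rintro _ ⟨⟨g, hg, rfl⟩, h0⟩
      rw [hcoe] at h0 ⊢
      have h0' : g.t / s = 0 := by rw [← ht]; exact h0
      have hgt : g.t = 0 := by simpa [hs] using h0'
      obtain ⟨k, m, n, rfl⟩ := hgen g hg hgt
      rw [map_mul, map_mul, map_zpow, map_zpow, map_zpow, hφα, hφβ, hφγ]
      exact mul_mem (zpow_mem (Subgroup.subset_closure (by simp)) _)
        (mul_mem (zpow_mem (Subgroup.subset_closure (by simp)) _)
          (zpow_mem (Subgroup.subset_closure (by simp)) _))
    · rw [Gam, Subgroup.closure_le]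
      rintro _ (rfl | rfl | rfl)
      · exact ⟨⟨γ, hγ, hφγ⟩, rfl⟩
      · exact ⟨⟨α, hα, hφα⟩, rfl⟩
      · exact ⟨⟨β, hβ, hφβ⟩, rfl⟩
  · ext a
    constructor
    · rintro ⟨_, ⟨g, hg, rfl⟩, rfl⟩
      obtain ⟨k, hk⟩ := (hT g.t).1 ⟨g, hg, rfl⟩
      refine ⟨k, ?_⟩
      rw [hcoe, ht, hk]
      field_simp
    · rintro ⟨k, rfl⟩
      obtain ⟨g, hg, hgt⟩ := (hT (k * s)).2 ⟨k, rfl⟩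
      refine ⟨φ g, ⟨g, hg, rfl⟩, ?_⟩
      rw [ht, hgt]
      field_simp

theorem C_conj (c : ComplexChart P) (g n : Osc P) (hn : n.t = 0) :
    c.C (g * n * g⁻¹).ξ = Complex.exp ((c.lam * g.t : ℝ) * Complex.I) * c.C n.ξ := by
  have h2 : (⟨n.z, n.ξ, 0⟩ : Osc P) = n := by rw [← hn]
  rw [← h2, conj_mk_zero, c.flow_apply]

theorem commutator_eq {α β : Osc P} (hα : α.t = 0) (hβ : β.t = 0) :
    α * β * α⁻¹ * β⁻¹ = ⟨P.ω α.ξ β.ξ, 0, 0⟩ := by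
  have e : (⟨β.z, β.ξ, 0⟩ : Osc P) = β := by rw [← hβ]
  rw [mul_inv_eq_iff_eq_mul]
  conv_lhs => rw [← e]
  rw [conj_mk_zero, hα, P.flow_zero, Matrix.one_mulVec]
  ext1 <;> simp [P.flow_zero, hβ, add_comm]

theorem commutator_mem {L : Subgroup (Osc P)} {α β : Osc P} (hα : α ∈ L) (hβ : β ∈ L)
    (hαt : α.t = 0) (hβt : β.t = 0) : (⟨P.ω α.ξ β.ξ, 0, 0⟩ : Osc P) ∈ L := by
  rw [← commutator_eq hαt hβt]
  exact mul_mem (mul_mem (mul_mem hα hβ) (inv_mem hα)) (inv_mem hβ)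

/-- The structure of a lattice in an oscillator group: generators of the center and of the
projections to `ℝ²` and to `ℝ`. -/
theorem IsLattice.exists_generators (c : ComplexChart P) {L : Subgroup (Osc P)}
    (hL : IsLattice L) :
    ∃ α ∈ L, ∃ β ∈ L, α.t = 0 ∧ β.t = 0 ∧ c.C α.ξ ≠ 0 ∧
      (∀ g ∈ L, g.t = 0 → ∃ m n : ℤ, c.C g.ξ = m * c.C α.ξ + n * c.C β.ξ) ∧
      (c.C β.ξ / c.C α.ξ).im ≠ 0 ∧ -(1 / 2) ≤ (c.C β.ξ / c.C α.ξ).re ∧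
      (c.C β.ξ / c.C α.ξ).re ≤ 0 ∧ 1 ≤ Complex.normSq (c.C β.ξ / c.C α.ξ) ∧
      (∃ q : ℝ, 0 < q ∧ ∀ a, (⟨a, 0, 0⟩ : Osc P) ∈ L ↔ ∃ k : ℤ, a = k * q) ∧
      ∃ p : ℝ, 0 < p ∧ ∀ a, (∃ g ∈ L, g.t = a) ↔ ∃ k : ℤ, a = k * p := by
  obtain ⟨hdisc, hcomp⟩ := hL
  have hfin := finite_inter_box c hdisc
  obtain ⟨α₀, hα₀, β₀, hβ₀, hα₀t, hβ₀t, hω⟩ := exists_ω_ne_zero hcomp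
  let Z : AddSubgroup ℝ :=
    { carrier := {a | (⟨a, 0, 0⟩ : Osc P) ∈ L}
      zero_mem' := one_mem L
      add_mem' := by
        intro a b (ha : _ ∈ L) (hb : _ ∈ L)
        have := mul_mem ha hb
        rwa [mk_mul_mk_zero, map_zero, mul_zero, add_zero, add_zero] at this
      neg_mem' := by
        intro a (ha : _ ∈ L)
        have := zpow_mem ha (-1)
        rw [zpow_mk] at this
        simpa using this }
  have hZ : ∀ a, a ∈ Z ↔ (⟨a, 0, 0⟩ : Osc P) ∈ L := fun a => Iff.rfl
  have hZfin : {a : ℝ | a ∈ Z ∧ |a| ≤ 1}.Finite := by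
    refine ((hfin 1).image Osc.z).subset ?_
    rintro a ⟨ha, ha1⟩
    exact ⟨⟨a, 0, 0⟩, ⟨ha, ha1, by simp, by simp⟩, rfl⟩
  obtain ⟨q, hq0, hq⟩ := Z.exists_generator_of_finite one_pos hZfin
  have hqpos : 0 < q := by
    refine lt_of_le_of_ne hq0 fun h => hω ?_
    have h1 : P.ω α₀.ξ β₀.ξ ∈ Z := by
      exact commutator_mem hα₀ hβ₀ hα₀t hβ₀t
    obtain ⟨k, hk⟩ := (hq _).1 h1
    rw [hk, ← h, mul_zero]
  let Λ : AddSubgroup ℂ :=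
    { carrier := {w | ∃ g ∈ L, g.t = 0 ∧ c.C g.ξ = w}
      zero_mem' := ⟨1, one_mem L, rfl, by simp⟩
      add_mem' := by
        rintro _ _ ⟨g, hg, hgt, rfl⟩ ⟨h, hh, hht, rfl⟩
        exact ⟨g * h, mul_mem hg hh, by simp [hgt, hht], by simp [hgt, P.flow_zero]⟩
      neg_mem' := by
        rintro _ ⟨g, hg, hgt, rfl⟩
        exact ⟨g⁻¹, inv_mem hg, by simp [hgt], by simp [hgt, P.flow_zero]⟩ }
  -- A central element of L brings z into [0, q) without changing ξ, so every bounded vector of Λ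
  -- comes from a lattice element in a box.
  have hΛfin : ∀ R : ℝ, {w : ℂ | w ∈ Λ ∧ ‖w‖ ≤ R}.Finite := by
    intro R
    refine ((hfin (max q R)).image (fun g => c.C g.ξ)).subset ?_
    rintro _ ⟨⟨g, hg, hgt, rfl⟩, hR⟩
    have hR0 : 0 ≤ R := (norm_nonneg _).trans hR
    refine ⟨⟨((-⌊g.z / q⌋ : ℤ) : ℝ) * q, 0, 0⟩ * g, ⟨mul_mem ((hq _).2 ⟨_, rfl⟩) hg, ?_, ?_, ?_⟩,
      ?_⟩
    · have h1 : ((⟨((-⌊g.z / q⌋ : ℤ) : ℝ) * q, 0, 0⟩ : Osc P) * g).z = Int.fract (g.z / q) * q := by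
        have h2 := Int.floor_add_fract (g.z / q)
        have h3 : g.z / q * q = g.z := div_mul_cancel₀ _ hqpos.ne'
        simp only [mul_z, map_zero, LinearMap.zero_apply, Int.cast_neg]
        linear_combination (-q) * h2 - h3
      rw [h1, abs_of_nonneg (mul_nonneg (Int.fract_nonneg _) hq0)]
      refine le_trans ?_ (le_max_left q R)
      exact mul_le_of_le_one_left hq0 (Int.fract_lt_one _).le
    · simp only [mul_ξ, P.flow_zero, Matrix.one_mulVec, zero_add]
      exact hR.trans (le_max_right q R)
    · simp [hgt, hR0]
    · simp [P.flow_zero]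
  have hΛind : ∃ u ∈ Λ, ∃ v ∈ Λ, ((starRingEnd ℂ) u * v).im ≠ 0 := by
    refine ⟨_, ⟨α₀, hα₀, hα₀t, rfl⟩, _, ⟨β₀, hβ₀, hβ₀t, rfl⟩, fun h => hω ?_⟩
    rw [c.ω_apply, h, mul_zero]
  obtain ⟨a, ⟨α, hα, hαt, rfl⟩, b, ⟨β, hβ, hβt, rfl⟩, ha0, hgen, hred⟩ :=
    Λ.exists_reduced_basis hΛfin hΛind
  refine ⟨α, hα, β, hβ, hαt, hβt, ha0, fun g hg hgt => hgen _ ⟨g, hg, hgt, rfl⟩, hred.1, hred.2.1,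
    hred.2.2.1, hred.2.2.2, ⟨q, hqpos, hq⟩, ?_⟩
  let T : AddSubgroup ℝ :=
    { carrier := {s | ∃ g ∈ L, g.t = s}
      zero_mem' := ⟨1, one_mem L, rfl⟩
      add_mem' := by
        rintro _ _ ⟨g, hg, rfl⟩ ⟨h, hh, rfl⟩
        exact ⟨g * h, mul_mem hg hh, rfl⟩
      neg_mem' := by
        rintro _ ⟨g, hg, rfl⟩
        exact ⟨g⁻¹, inv_mem hg, rfl⟩ }
  have hlam : 0 < |c.lam| := abs_pos.2 c.lam_ne
  -- Conjugates of α project to vectors of Λ of norm |α|, of which there are finitely many. The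
  -- window 1/|lam| keeps two angles less than 2π apart, so the rotated vector determines the time.
  have hTfin : {s : ℝ | s ∈ T ∧ |s| ≤ 1 / |c.lam|}.Finite := by
    refine Set.Finite.of_finite_image (f := fun s : ℝ =>
      Complex.exp ((c.lam * s : ℝ) * Complex.I) * c.C α.ξ) ((hΛfin ‖c.C α.ξ‖).subset ?_) ?_
    · rintro _ ⟨_, ⟨⟨g, hg, rfl⟩, -⟩, rfl⟩
      refine ⟨⟨g * α * g⁻¹, mul_mem (mul_mem hg hα) (inv_mem hg), by simp [hαt], C_conj c g α hαt⟩, ?_⟩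
      rw [norm_mul, Complex.norm_exp_ofReal_mul_I, one_mul]
    · rintro s ⟨-, hs⟩ s' ⟨-, hs'⟩ h
      have h1 := mul_right_cancel₀ ha0 h
      obtain ⟨k, hk⟩ := Complex.exp_eq_exp_iff_exists_int.1 h1
      have h2 : c.lam * s = c.lam * s' + k * (2 * Real.pi) := by
        have := congrArg Complex.im hk
        simpa using this
      have h3 : ∀ {s : ℝ}, |s| ≤ 1 / |c.lam| → |c.lam * s| ≤ 1 := by
        intro s hs
        rw [abs_mul, mul_comm]
        rwa [le_div_iff₀ hlam] at hs
      have h4 := abs_le.1 (h3 hs)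
      have h5 := abs_le.1 (h3 hs')
      have hk0 : k = 0 := by
        have hπ := Real.pi_gt_three
        have h6 : (k : ℝ) < 1 := by nlinarith
        have h7 : (-1 : ℝ) < k := by nlinarith
        have h8 : k < 1 := by exact_mod_cast h6
        have h9 : -1 < k := by exact_mod_cast h7
        omega
      rw [hk0] at h2
      simp only [Int.cast_zero, zero_mul, add_zero] at h2
      exact mul_left_cancel₀ c.lam_ne h2
  obtain ⟨p, hp0, hp⟩ := T.exists_generator_of_finite (by positivity) hTfin
  refine ⟨p, lt_of_le_of_ne hp0 fun h => ?_, hp⟩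
  -- If p were 0, L would not move t and could not bring the time |R| + 1 into the box.
  obtain ⟨R, hR⟩ := exists_mul_mem_box c hcomp
  obtain ⟨l, hl, -, -, hlt⟩ := hR ⟨0, 0, |R| + 1⟩
  obtain ⟨k, hk⟩ := (hp l.t).1 ⟨l, hl, rfl⟩
  rw [mul_t, hk, ← h, mul_zero, zero_add, abs_of_pos (by positivity)] at hlt
  linarith [le_abs_self R]

end Osc

/-! ### The crystallographic restriction. -/

/-- Subtracting a multiple of π moves θ into (0, π] and changes 2cos θ at most by sign. There 2cos
is injective with values in [-2, 2), leaving -2, -1, 0, 1. -/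
theorem Real.exists_two_mul_cos_int {θ : ℝ} (hθ : 0 < θ) {j : ℤ} (hj : 2 * Real.cos θ = j) :
    ∃ (θ₀ : ℝ) (k : ℕ), θ = θ₀ + k * Real.pi ∧
      (θ₀ = Real.pi / 3 ∨ θ₀ = 2 * Real.pi / 3 ∨ θ₀ = Real.pi / 2 ∨ θ₀ = Real.pi) := by
  have hπ := Real.pi_pos
  obtain ⟨k, hk⟩ : ∃ k : ℕ, 0 < θ - k * Real.pi ∧ θ - k * Real.pi ≤ Real.pi := by
    have hc : 1 ≤ ⌈θ / Real.pi⌉ := Int.one_le_ceil_iff.2 (by positivity)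
    obtain ⟨k, hk⟩ := Int.eq_ofNat_of_zero_le (sub_nonneg.2 hc)
    refine ⟨k, ?_⟩
    have h1 := Int.ceil_lt_add_one (θ / Real.pi)
    have h2 := Int.le_ceil (θ / Real.pi)
    have hkR : (⌈θ / Real.pi⌉ : ℝ) - 1 = k := by exact_mod_cast hk
    have h3 : (k : ℝ) < θ / Real.pi := by linarith
    have h4 : θ / Real.pi ≤ k + 1 := by linarith
    rw [lt_div_iff₀ hπ] at h3
    rw [div_le_iff₀ hπ] at h4
    constructor <;> linarith
  set θ₀ := θ - k * Real.pi with hθ₀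
  refine ⟨θ₀, k, by rw [hθ₀]; ring, ?_⟩
  have hcos : 2 * Real.cos θ₀ = (((-1) ^ k * j : ℤ) : ℝ) := by
    rw [hθ₀, Real.cos_sub_nat_mul_pi]
    push_cast
    rw [← hj]
    ring
  set j' : ℤ := (-1) ^ k * j
  have h1 : -2 ≤ j' := by
    have : (-2 : ℝ) ≤ j' := by rw [← hcos]; linarith [Real.neg_one_le_cos θ₀]
    exact_mod_cast this
  have h2 : j' < 2 := by
    have hlt : Real.cos θ₀ < 1 := by
      have := Real.cos_lt_cos_of_nonneg_of_le_pi le_rfl hk.2 hk.1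
      rwa [Real.cos_zero] at this
    have : (j' : ℝ) < 2 := by rw [← hcos]; linarith
    exact_mod_cast this
  have hinj : ∀ ψ : ℝ, 0 ≤ ψ → ψ ≤ Real.pi → Real.cos θ₀ = Real.cos ψ → θ₀ = ψ := fun ψ h0 h1 h =>
    Real.injOn_cos ⟨hk.1.le, hk.2⟩ ⟨h0, h1⟩ h
  have e : 2 * Real.pi / 3 = Real.pi - Real.pi / 3 := by ring
  have hj' : j' = -2 ∨ j' = -1 ∨ j' = 0 ∨ j' = 1 := by omega
  rcases hj' with h | h | h | h <;> rw [h] at hcos <;> push_cast at hcos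
  · right; right; right
    exact hinj _ hπ.le le_rfl (by rw [Real.cos_pi]; linarith)
  · right; left
    refine hinj _ (by positivity) (by linarith) ?_
    rw [e, Real.cos_pi_sub, Real.cos_pi_div_three]
    linarith
  · right; right; left
    refine hinj _ (by positivity) (by linarith) ?_
    rw [Real.cos_pi_div_two]
    linarith
  · left
    refine hinj _ (by positivity) (by linarith) ?_
    rw [Real.cos_pi_div_three]
    linarith

/-- A rotation preserving the lattice `ℤ + ℤ w` with reduced `w` is one of the admissible ones. -/
theorem admissible_of_rotation {θ x y : ℝ} (hθ : 0 < θ) (hxy : (x, y) ∈ halfDomain) {m n k l : ℤ}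
    (h1 : Complex.exp (θ * Complex.I) = m + n * (⟨-x, y⟩ : ℂ))
    (h2 : Complex.exp (θ * Complex.I) * (⟨-x, y⟩ : ℂ) = k + l * (⟨-x, y⟩ : ℂ)) :
    ∃ (lam0 : ℝ) (k : ℕ), θ = lam0 + k * Real.pi ∧
      ((lam0 = Real.pi / 3 ∨ lam0 = 2 * Real.pi / 3) ∧ (x, y) = (1 / 2, Real.sqrt 3 / 2) ∨
        lam0 = Real.pi / 2 ∧ (x, y) = (0, 1) ∨
        lam0 = Real.pi ∧ (x, y) ∈ halfDomain) := by
  obtain ⟨hx0, hx1, hy, hxy1⟩ := hxy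
  simp only at hx0 hx1 hy hxy1
  have hre := congrArg Complex.re h1
  have him := congrArg Complex.im h1
  have him2 := congrArg Complex.im h2
  rw [Complex.exp_ofReal_mul_I_re] at hre
  rw [Complex.exp_ofReal_mul_I_im] at him
  rw [Complex.mul_im, Complex.exp_ofReal_mul_I_im, Complex.exp_ofReal_mul_I_re] at him2
  simp at hre him him2
  have hcos : Real.cos θ = l + n * x := by
    rw [him] at him2
    have : y * (Real.cos θ - (l + n * x)) = 0 := by linear_combination him2
    rcases mul_eq_zero.1 this with h | h
    · exact absurd h hy.ne'
    · linarith
  -- The trace m + l of the integral matrix is 2cos θ: add cos θ = m - nx and cos θ = l + nx.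
  obtain ⟨θ₀, j, hj, hcases⟩ := Real.exists_two_mul_cos_int hθ (j := m + l)
    (by push_cast; linarith)
  refine ⟨θ₀, j, hj, ?_⟩
  have hs : Real.sin θ = (-1) ^ j * Real.sin θ₀ := by rw [hj, Real.sin_add_nat_mul_pi]
  have hc : Real.cos θ = (-1) ^ j * Real.cos θ₀ := by rw [hj, Real.cos_add_nat_mul_pi]
  have hpm : ((-1 : ℝ) ^ j) ^ 2 = 1 := by rw [← pow_mul, mul_comm, pow_mul]; simp
  have hsq : Real.sin θ₀ ^ 2 = n ^ 2 * y ^ 2 := by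
    have : Real.sin θ ^ 2 = n ^ 2 * y ^ 2 := by rw [him]; ring
    rw [← this, hs, mul_pow, hpm, one_mul]
  have hcq : Real.cos θ₀ ^ 2 = (m - n * x) ^ 2 := by
    have : Real.cos θ ^ 2 = (m - n * x) ^ 2 := by rw [hre]; ring
    rw [← this, hc, mul_pow, hpm, one_mul]
  have hy2 : 3 / 4 ≤ y ^ 2 := by nlinarith
  have hn1 : n ≠ 0 → 1 ≤ (n : ℝ) ^ 2 := by
    intro h
    have : 1 ≤ n ^ 2 := by have := sq_pos_of_ne_zero h; omega
    exact_mod_cast this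
  -- Applied with s = sin²θ₀: since y² ≥ 3/4, a nonzero sine gives 0 < n² ≤ 4/3.
  have hn2 : ∀ {s : ℝ}, s ≤ 1 → 0 < s → s = n ^ 2 * y ^ 2 → (n : ℝ) ^ 2 = 1 := by
    intro s hs1 hs0 hs
    have hn0 : n ≠ 0 := by
      rintro rfl
      simp at hs
      linarith
    have h5 : (n : ℝ) ^ 2 < 2 := by nlinarith
    have h6 : n ^ 2 < 2 := by exact_mod_cast h5
    have h7 : 0 < n ^ 2 := sq_pos_of_ne_zero hn0
    have h8 : n ^ 2 = 1 := by omega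
    exact_mod_cast h8
  have hthird : Real.sin θ₀ ^ 2 = 3 / 4 → Real.cos θ₀ ^ 2 = 1 / 4 →
      (x, y) = (1 / 2, Real.sqrt 3 / 2) := by
    intro hs2 hc2
    rw [hs2] at hsq
    have hnn := hn2 (by norm_num) (by norm_num) hsq
    rw [hnn, one_mul] at hsq
    have hx2 : 1 / 4 ≤ x ^ 2 := by linarith
    have hxh : x = 1 / 2 := by nlinarith
    refine Prod.ext hxh ?_
    simp only
    rw [eq_div_iff two_ne_zero, eq_comm, Real.sqrt_eq_iff_mul_self_eq (by norm_num) (by positivity)]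
    linarith
  rcases hcases with h | h | h | h
  · refine Or.inl ⟨Or.inl h, hthird ?_ ?_⟩
    · rw [h, Real.sin_pi_div_three, div_pow, Real.sq_sqrt (by norm_num)]
      norm_num
    · rw [h, Real.cos_pi_div_three]
      norm_num
  · have e : 2 * Real.pi / 3 = Real.pi - Real.pi / 3 := by ring
    refine Or.inl ⟨Or.inr h, hthird ?_ ?_⟩
    · rw [h, e, Real.sin_pi_sub, Real.sin_pi_div_three, div_pow, Real.sq_sqrt (by norm_num)]
      norm_num
    · rw [h, e, Real.cos_pi_sub, Real.cos_pi_div_three]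
      norm_num
  · refine Or.inr (Or.inl ⟨h, ?_⟩)
    rw [h, Real.sin_pi_div_two, one_pow] at hsq
    rw [h, Real.cos_pi_div_two] at hcq
    have hnn := hn2 le_rfl one_pos hsq
    rw [hnn, one_mul] at hsq
    have hy1 : y = 1 := by nlinarith
    have hmn : (m : ℝ) = n * x := by
      have : (m - n * x : ℝ) ^ 2 = 0 := by rw [← hcq]; norm_num
      have := pow_eq_zero_iff (two_ne_zero) |>.1 this
      linarith
    have hm2 : (m : ℝ) ^ 2 = x ^ 2 := by rw [hmn, mul_pow, hnn, one_mul]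
    have hm1 : (m : ℝ) ^ 2 < 1 := by rw [hm2]; nlinarith
    have hm1' : m ^ 2 < 1 := by exact_mod_cast hm1
    have hm0 : m = 0 := by nlinarith
    rw [hm0] at hm2
    have hx : x = 0 := by
      have : x ^ 2 = 0 := by rw [← hm2]; norm_num
      exact pow_eq_zero_iff two_ne_zero |>.1 this
    exact Prod.ext hx hy1
  · exact Or.inr (Or.inr ⟨h, hx0, hx1, hy, hxy1⟩)

theorem Complex.exists_algEquiv_im_pos {τ : ℂ} (h : τ.im ≠ 0) :
    ∃ (σ : ℂ ≃ₐ[ℝ] ℂ) (ε : ℝ), ε * ε = 1 ∧ 0 < ε * τ.im ∧ ∀ w, σ w = ⟨w.re, ε * w.im⟩ := by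
  rcases lt_or_gt_of_ne h with h | h
  · exact ⟨Complex.conjAe, -1, by norm_num, by linarith, fun w => by
      apply Complex.ext <;> simp⟩
  · exact ⟨AlgEquiv.refl, 1, by norm_num, by linarith, fun w => by
      apply Complex.ext <;> simp⟩

/-! ### Bringing a lattice into normal form. -/

namespace Osc

variable {P : OscParam}

theorem exists_normalizing_iso {L : Subgroup (Osc P)} (hL : IsLattice L) :
    ∃ (d : LatticeData) (φ : Osc P ≃ₜ* Osc d.param),
      IsNormalized (L.map (φ.toMulEquiv : Osc P →* Osc d.param)) := by
  obtain ⟨c⟩ := P.nonempty_complexChart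
  obtain ⟨α, hα, β, hβ, hαt, hβt, ha0, hgen, him, hre1, hre0, hns, ⟨q, hq0, hq⟩, p, hp0, hp⟩ :=
    hL.exists_generators c
  set a := c.C α.ξ with ha
  set τ := c.C β.ξ / a with hτ
  have hb : c.C β.ξ = τ * a := by rw [hτ, div_mul_cancel₀ _ ha0]
  obtain ⟨σ, ε, hε, hεim, hσ⟩ := Complex.exists_algEquiv_im_pos him
  have hε0 : ε ≠ 0 := by
    rintro rfl
    simp at hε
  -- The direction of time is chosen so that the angle after applying σ is positive.
  obtain ⟨s, hsp, hsθ⟩ : ∃ s : ℝ, (s = p ∨ s = -p) ∧ 0 < ε * c.lam * s := by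
    rcases lt_or_gt_of_ne (mul_ne_zero hε0 c.lam_ne) with h | h
    · exact ⟨-p, Or.inr rfl, by nlinarith⟩
    · exact ⟨p, Or.inl rfl, by positivity⟩
  have hs0 : s ≠ 0 := by
    rintro rfl
    simp at hsθ
  have hT : ∀ b : ℝ, (∃ g ∈ L, g.t = b) ↔ ∃ k : ℤ, b = k * s := by
    intro b
    rw [hp]
    rcases hsp with rfl | rfl
    · rfl
    · exact ⟨fun ⟨k, hk⟩ => ⟨-k, by rw [hk]; push_cast; ring⟩,
        fun ⟨k, hk⟩ => ⟨-k, by rw [hk]; push_cast; ring⟩⟩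
  have hσexp : ∀ t : ℝ, σ (Complex.exp ((t : ℝ) * Complex.I))
      = Complex.exp ((ε * t : ℝ) * Complex.I) := by
    intro t
    have hεc : ε = 1 ∨ ε = -1 := mul_self_eq_one_iff.1 hε
    rw [hσ]
    apply Complex.ext
    · simp only [Complex.exp_ofReal_mul_I_re]
      rcases hεc with rfl | rfl <;> simp
    · simp only [Complex.exp_ofReal_mul_I_im]
      rcases hεc with rfl | rfl <;> simp
  obtain ⟨x, hx⟩ : ∃ x : ℝ, x = -τ.re := ⟨_, rfl⟩
  obtain ⟨y, hy⟩ : ∃ y : ℝ, y = ε * τ.im := ⟨_, rfl⟩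
  have hστ : σ τ = ⟨-x, y⟩ := by rw [hσ, hx, hy, neg_neg]
  have hxy : (x, y) ∈ halfDomain := by
    refine ⟨?_, ?_, ?_, ?_⟩
    · simp only [hx]; linarith
    · simp only [hx]; linarith
    · simp only [hy]; exact hεim
    · simp only [hx, hy]
      rw [Complex.normSq_apply] at hns
      linear_combination hns - τ.im ^ 2 * hε
  obtain ⟨g, hg, hgs⟩ := (hT s).2 ⟨1, by simp⟩
  -- Conjugating α and β by g over s shows that rotation by `c.lam * s` is integral in the basis a,
  -- τa; dividing by a and applying σ gives the reduced situation.
  have hadm : ∃ (lam0 : ℝ) (k : ℕ), ε * c.lam * s = lam0 + k * Real.pi ∧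
      ((lam0 = Real.pi / 3 ∨ lam0 = 2 * Real.pi / 3) ∧ (x, y) = (1 / 2, Real.sqrt 3 / 2) ∨
        lam0 = Real.pi / 2 ∧ (x, y) = (0, 1) ∨
        lam0 = Real.pi ∧ (x, y) ∈ halfDomain) := by
    obtain ⟨m, n, h1⟩ := hgen (g * α * g⁻¹) (mul_mem (mul_mem hg hα) (inv_mem hg)) (by simp [hαt])
    obtain ⟨k, l, h2⟩ := hgen (g * β * g⁻¹) (mul_mem (mul_mem hg hβ) (inv_mem hg)) (by simp [hβt])
    rw [C_conj c g α hαt, ← ha, hb, hgs] at h1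
    rw [C_conj c g β hβt, hb, hgs] at h2
    have h1' := congrArg σ (mul_right_cancel₀ ha0 (h1.trans (by ring :
      (m : ℂ) * a + n * (τ * a) = (m + n * τ) * a)))
    have h2' := congrArg σ (mul_right_cancel₀ ha0 ((mul_assoc _ _ _).trans (h2.trans (by ring :
      (k : ℂ) * a + l * (τ * a) = (k + l * τ) * a))))
    rw [hσexp, map_add, map_mul, map_intCast, map_intCast, hστ, ← mul_assoc] at h1'
    rw [map_mul, hσexp, map_add, map_mul, map_intCast, map_intCast, hστ, ← mul_assoc] at h2'
    exact admissible_of_rotation hsθ hxy h1' h2'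
  set W := P.ω α.ξ β.ξ with hW
  obtain ⟨M, hM⟩ := (hq W).1 (commutator_mem hα hβ hαt hβt)
  have hWτ : W = c.κ * (Complex.normSq a * τ.im) := by
    rw [hW, c.ω_apply, hb, ← ha, mul_left_comm, mul_comm ((starRingEnd ℂ) a), Complex.mul_conj,
      Complex.im_mul_ofReal]
    ring
  have hna : Complex.normSq a ≠ 0 := Complex.normSq_eq_zero.not.2 ha0
  have hW0 : W ≠ 0 := hWτ ▸ mul_ne_zero c.κ_ne (mul_ne_zero hna him)
  have hM0 : M ≠ 0 := by
    rintro rfl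
    simp at hM
    exact hW0 hM
  let d : LatticeData := ⟨M.natAbs, ε * c.lam * s, x, y, Int.natAbs_pos.2 hM0, hadm⟩
  have hdr : (d.r : ℝ) = M.sign * M := by
    have := Int.sign_mul_self_eq_natAbs M
    show ((M.natAbs : ℕ) : ℝ) = _
    rw [← Int.cast_natCast, ← this, Int.cast_mul]
  have hsgn : (M.sign : ℝ) * M.sign = 1 := by
    have : M.sign * M.sign = 1 := by
      rcases lt_or_gt_of_ne hM0 with h | h
      · rw [Int.sign_eq_neg_one_of_neg h]; rfl
      · rw [Int.sign_eq_one_of_pos h]; rfl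
    exact_mod_cast this
  have hMR : (M : ℝ) ≠ 0 := by exact_mod_cast hM0
  have hdr0 : (d.r : ℝ) ≠ 0 := by exact_mod_cast d.r_pos.ne'
  let S : (Fin 2 → ℝ) ≃ₗ[ℝ] (Fin 2 → ℝ) :=
    ((c.C.trans ((LinearEquiv.smulOfNeZero ℂ ℂ a⁻¹ (inv_ne_zero ha0)).restrictScalars ℝ)).trans
      σ.toLinearEquiv).trans d.chart.C.symm
  have hS : ∀ ξ, d.chart.C (S ξ) = σ (c.C ξ / a) := by
    intro ξ
    simp [S, div_eq_inv_mul]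
  -- This scaling turns the commutator W = Mq into r = |M|, hence sign(M)·q into 1.
  set μ : ℝ := d.r / W with hμdef
  have hμ : μ ≠ 0 := div_ne_zero hdr0 hW0
  have hω : ∀ ξ η, d.param.ω (S ξ) (S η) = μ * P.ω ξ η := by
    intro ξ η
    rw [d.chart.ω_apply, hS, hS, c.ω_apply, d.chart_κ]
    have h1 : ∀ u v : ℂ, ((starRingEnd ℂ) (σ u) * σ v).im = ε * ((starRingEnd ℂ) u * v).im := by
      intro u v
      rw [hσ, hσ]
      simp
      ring
    have h2 : ((starRingEnd ℂ) (c.C ξ / a) * (c.C η / a)).im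
        = ((starRingEnd ℂ) (c.C ξ) * c.C η).im / Complex.normSq a := by
      rw [map_div₀, div_mul_div_comm, mul_comm ((starRingEnd ℂ) a), Complex.mul_conj,
        Complex.div_ofReal_im]
    have hyd : d.y = ε * τ.im := hy
    have hκ := c.κ_ne
    rw [h1, h2, hμdef, hWτ, hyd]
    field_simp
  have hflow : ∀ t ξ, S (P.flow t *ᵥ ξ) = d.param.flow (s⁻¹ * t) *ᵥ S ξ := by
    intro t ξ
    apply d.chart.C.injective
    have hlam : d.chart.lam * (s⁻¹ * t) = ε * (c.lam * t) := by
      show ε * c.lam * s * (s⁻¹ * t) = _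
      field_simp
    rw [hS, d.chart.flow_apply, hS, c.flow_apply, mul_div_assoc, map_mul, hσexp, hlam]
  let ψ := linearIso S hμ (inv_ne_zero hs0) hω hflow
  have hψ : ∀ g, ψ g = ⟨μ * g.z, S g.ξ, s⁻¹ * g.t⟩ := fun g => rfl
  -- Conjugation by (0, v, 0) adds ω_r(v, Sξ) to z; v is solved from cancelling the z-coordinates
  -- μα.z and μβ.z over e₁ and e₂.
  let v : Fin 2 → ℝ := ![-(μ * β.z / d.r), μ * α.z / d.r]
  have hSα : S α.ξ = Pi.single 0 1 := by
    apply d.chart.C.injective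
    rw [hS, ← ha, div_self ha0, map_one, d.chart_C]
    apply Complex.ext <;> simp
  have hSβ : S β.ξ = Pi.single 1 1 := by
    apply d.chart.C.injective
    rw [hS, hb, mul_div_cancel_right₀ _ ha0, hστ, d.chart_C]
    apply Complex.ext <;> simp [d]
  have hαmk : α = ⟨α.z, α.ξ, 0⟩ := by rw [← hαt]
  have hβmk : β = ⟨β.z, β.ξ, 0⟩ := by rw [← hβt]
  have hφ : ∀ g : Osc P, g.t = 0 → (ψ.trans (conjEquiv ⟨0, v, 0⟩)) g =
      ⟨μ * g.z + d.param.ω v (S g.ξ), S g.ξ, 0⟩ := by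
    intro g hgt
    show conjEquiv ⟨0, v, 0⟩ (ψ g) = _
    rw [hψ, hgt, mul_zero, conjEquiv_apply, conj_mk_zero, d.param.flow_zero, Matrix.one_mulVec]
  have hWμ : μ * (M.sign * q) = 1 := by
    rw [hμdef, hdr, hM]
    field_simp
    linear_combination hsgn
  refine ⟨d, ψ.trans (conjEquiv ⟨0, v, 0⟩), isNormalized_map (α := α) (β := β)
    (γ := ⟨M.sign * q, 0, 0⟩) _ hs0 hα hβ ((hq _).2 ⟨_, rfl⟩) ?_ ?_ ?_ ?_ ?_ hT⟩
  · rw [hφ α hαt, hSα, d.param_ω]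
    ext1
    · simp [v]
      field_simp
      ring
    · rfl
    · rfl
  · rw [hφ β hβt, hSβ, d.param_ω]
    ext1
    · simp [v]
      field_simp
      ring
    · rfl
    · rfl
  · rw [hφ _ rfl]
    simp [hWμ]
  · intro g
    show (conjEquiv ⟨0, v, 0⟩ (ψ g)).t = _
    rw [conjEquiv_apply, hψ]
    simp
    ring
  · intro g hg hgt
    obtain ⟨m, n, hmn⟩ := hgen g hg hgt
    have hgξ : g.ξ = (m : ℝ) • α.ξ + (n : ℝ) • β.ξ := by
      apply c.C.injective
      rw [hmn, map_add, map_smul, map_smul]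
      simp [ha]
    obtain ⟨z₁, hz₁⟩ : ∃ z₁, α ^ m * β ^ n = ⟨z₁, g.ξ, 0⟩ := by
      rw [hαmk, hβmk, zpow_mk, zpow_mk, mk_mul_mk_zero, hgξ]
      exact ⟨_, rfl⟩
    have hg' : g = ⟨g.z - z₁, 0, 0⟩ * (α ^ m * β ^ n) := by
      rw [hz₁, mk_mul_mk_zero]
      ext1 <;> simp [hgt]
    have hmem : (⟨g.z - z₁, 0, 0⟩ : Osc P) ∈ L := by
      rw [← mul_inv_eq_iff_eq_mul] at hg'
      rw [← hg']
      exact mul_mem hg (inv_mem (mul_mem (zpow_mem hα _) (zpow_mem hβ _)))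
    obtain ⟨k, hk⟩ := (hq _).1 hmem
    refine ⟨k * M.sign, m, n, ?_⟩
    conv_lhs => rw [hg', hk]
    rw [zpow_mk, smul_zero]
    congr 2
    push_cast
    linear_combination (-k * q) * hsgn

end Osc

/-! ### Rigidity of isomorphisms between oscillator groups. -/

theorem OscParam.eq_zero_of_ω {P : OscParam} {ξ : Fin 2 → ℝ} (h : ∀ η, P.ω ξ η = 0) : ξ = 0 := by
  obtain ⟨c⟩ := P.nonempty_complexChart
  have h1 := h (c.C.symm (Complex.I * c.C ξ))
  rw [c.ω_apply, LinearEquiv.apply_symm_apply] at h1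
  have h2 : ((starRingEnd ℂ) (c.C ξ) * (Complex.I * c.C ξ)).im = Complex.normSq (c.C ξ) := by
    rw [Complex.normSq_apply]
    simp
  rw [h2] at h1
  simpa using (mul_eq_zero.1 h1).resolve_left c.κ_ne

namespace Osc

variable {P Q : OscParam}

theorem ξ_conj (g : Osc P) {n : Osc P} (hn : n.t = 0) :
    (g * n * g⁻¹).ξ = P.flow g.t *ᵥ n.ξ := by
  have h : (⟨n.z, n.ξ, 0⟩ : Osc P) = n := by rw [← hn]
  rw [← h, conj_mk_zero]

/-- The projection `Π` to the last coordinate, as a homomorphism. -/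
noncomputable def tHom (P : OscParam) : Osc P →* Multiplicative ℝ where
  toFun g := Multiplicative.ofAdd g.t
  map_one' := rfl
  map_mul' _ _ := rfl

/-- Heisenberg commutators fill the z-axis. At time π/lam the flow is -1, so its commutator with
-ξ/2 is ξ. Consequently every isomorphism preserves H₁. -/
theorem mem_commutator_iff (g : Osc P) : g ∈ commutator (Osc P) ↔ g.t = 0 := by
  constructor
  · intro h
    exact Abelianization.commutator_subset_ker (tHom P) h
  · intro h
    obtain ⟨c⟩ := P.nonempty_complexChart
    have hcomm : ∀ a b : Osc P, a * b * a⁻¹ * b⁻¹ ∈ commutator (Osc P) := fun a b =>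
      Subgroup.commutator_mem_commutator (Subgroup.mem_top a) (Subgroup.mem_top b)
    have h1 : ∀ z, (⟨z, 0, 0⟩ : Osc P) ∈ commutator (Osc P) := by
      intro z
      have := hcomm ⟨0, c.C.symm 1, 0⟩ ⟨0, c.C.symm ((z / c.κ : ℝ) * Complex.I), 0⟩
      rw [commutator_eq rfl rfl, c.ω_apply] at this
      simpa [mul_div_cancel₀ _ c.κ_ne] using this
    have h2 : ∀ ξ, (⟨0, ξ, 0⟩ : Osc P) ∈ commutator (Osc P) := by
      intro ξ
      have hfl : P.flow (Real.pi / c.lam) *ᵥ (-(1 / 2 : ℝ) • ξ) = (1 / 2 : ℝ) • ξ := by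
        apply c.C.injective
        rw [c.flow_apply, mul_div_cancel₀ _ c.lam_ne, Complex.exp_pi_mul_I, map_smul, map_smul]
        simp
      have := hcomm ⟨0, 0, Real.pi / c.lam⟩ ⟨0, -(1 / 2 : ℝ) • ξ, 0⟩
      rw [conj_mk_zero, hfl] at this
      convert this using 1
      ext1
      · simp [P.flow_zero, P.alt.self_eq_zero]
      · simp only [mul_ξ, inv_ξ, neg_zero, P.flow_zero, Matrix.one_mulVec]
        rw [neg_smul, neg_neg, ← add_smul]
        norm_num
      · simp
    have h3 : g = ⟨g.z, 0, 0⟩ * ⟨0, g.ξ, 0⟩ := by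
      rw [mk_mul_mk_zero]
      ext1 <;> simp [h]
    rw [h3]
    exact mul_mem (h1 _) (h2 _)

theorem t_map_eq_zero (ψ : Osc P ≃* Osc Q) {g : Osc P} (hg : g.t = 0) : (ψ g).t = 0 := by
  rw [← mem_commutator_iff] at hg ⊢
  have h := Subgroup.mem_map_of_mem (ψ : Osc P →* Osc Q) hg
  rw [commutator_def, Subgroup.map_commutator] at h
  exact Subgroup.commutator_mono le_top le_top h

/-- Such g commutes with all of H₁, a property carried over by ψ; nondegeneracy of the target form
then kills ξ. -/
theorem ξ_map_eq_zero (ψ : Osc P ≃* Osc Q) {g : Osc P} (hg : g.t = 0) (hξ : g.ξ = 0) :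
    (ψ g).ξ = 0 := by
  apply Q.eq_zero_of_ω
  intro η
  obtain ⟨h, hh⟩ := ψ.surjective ⟨0, η, 0⟩
  have hht : h.t = 0 := by
    have := t_map_eq_zero ψ.symm (g := ψ h) (by rw [hh])
    simpa using this
  have h1 := commutator_eq (P := P) hg hht
  rw [hξ, map_zero, LinearMap.zero_apply] at h1
  have h2 := congrArg ψ h1
  rw [map_mul, map_mul, map_mul, map_inv, map_inv,
    commutator_eq (t_map_eq_zero ψ hg) (t_map_eq_zero ψ hht), hh] at h2
  have h3 : (⟨0, 0, 0⟩ : Osc P) = 1 := rfl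
  rw [h3, map_one] at h2
  exact congrArg Osc.z h2

theorem ξ_map_of_t_eq_zero (ψ : Osc P ≃* Osc Q) {g : Osc P} (hg : g.t = 0) :
    (ψ g).ξ = (ψ ⟨0, g.ξ, 0⟩).ξ := by
  have h3 : g = ⟨g.z, 0, 0⟩ * ⟨0, g.ξ, 0⟩ := by
    rw [mk_mul_mk_zero]
    ext1 <;> simp [hg]
  conv_lhs => rw [h3]
  rw [map_mul, mul_ξ, ξ_map_eq_zero ψ rfl rfl, t_map_eq_zero ψ rfl, Q.flow_zero, Matrix.one_mulVec,
    zero_add]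

/-- The linear map induced on `ℝ²` by an isomorphism of oscillator groups. -/
noncomputable def planeMap (ψ : Osc P ≃ₜ* Osc Q) : (Fin 2 → ℝ) →L[ℝ] (Fin 2 → ℝ) :=
  AddMonoidHom.toRealLinearMap
    { toFun := fun ξ => (ψ ⟨0, ξ, 0⟩).ξ
      map_zero' := ξ_map_eq_zero ψ.toMulEquiv rfl rfl
      map_add' := by
        intro ξ η
        have h := ξ_map_of_t_eq_zero ψ.toMulEquiv (g := ⟨0, ξ, 0⟩ * ⟨0, η, 0⟩) (by simp)
        rw [map_mul, mul_ξ, t_map_eq_zero ψ.toMulEquiv rfl, Q.flow_zero, Matrix.one_mulVec, mul_ξ,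
          P.flow_zero, Matrix.one_mulVec] at h
        exact h.symm }
    (continuous_ξ.comp (ψ.continuous.comp
      (continuous_mk continuous_const continuous_id continuous_const)))

theorem ξ_map (ψ : Osc P ≃ₜ* Osc Q) {g : Osc P} (hg : g.t = 0) :
    (ψ g).ξ = planeMap ψ g.ξ := ξ_map_of_t_eq_zero ψ.toMulEquiv hg

theorem map_map_symm (ψ : Osc P ≃ₜ* Osc Q) (L : Subgroup (Osc P)) :
    (L.map (ψ.toMulEquiv : Osc P →* Osc Q)).map (ψ.symm.toMulEquiv : Osc Q →* Osc P) = L := by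
  rw [Subgroup.map_map]
  convert Subgroup.map_id L
  ext g : 1
  exact ψ.symm_apply_apply g

/-- An isomorphism of oscillator groups rescales the last coordinate. -/
theorem t_map (ψ : Osc P ≃ₜ* Osc Q) (g : Osc P) : (ψ g).t = g.t * (ψ ⟨0, 0, 1⟩).t := by
  let f : ℝ →+ ℝ :=
    { toFun := fun t => (ψ ⟨0, 0, t⟩).t
      map_zero' := t_map_eq_zero ψ.toMulEquiv rfl
      map_add' := by
        intro s t
        have : (⟨0, 0, s + t⟩ : Osc P) = ⟨0, 0, s⟩ * ⟨0, 0, t⟩ := by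
          ext1 <;> simp
        rw [this, map_mul, mul_t] }
  have hf : Continuous f := continuous_t.comp (ψ.continuous.comp
    (continuous_mk continuous_const continuous_const continuous_id))
  have h1 : g = ⟨g.z, g.ξ, 0⟩ * ⟨0, 0, g.t⟩ := by
    rw [mk_mul_mk_zero]
    ext1 <;> simp
  have h2 : (ψ g).t = f g.t := by
    conv_lhs => rw [h1, map_mul, mul_t]
    have h3 : (ψ ⟨g.z, g.ξ, 0⟩).t = 0 := t_map_eq_zero ψ.toMulEquiv rfl
    rw [h3, zero_add]
    rfl
  have h4 := map_real_smul f hf g.t 1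
  rw [smul_eq_mul, mul_one, smul_eq_mul] at h4
  rw [h2, h4]
  rfl

/-- The flow is conjugation by (0, 0, t) seen on ℝ², so ψ intertwines the two flows up to its
scaling of time. -/
theorem planeMap_flow (ψ : Osc P ≃ₜ* Osc Q) (t : ℝ) (ξ : Fin 2 → ℝ) :
    planeMap ψ (P.flow t *ᵥ ξ) = Q.flow (t * (ψ ⟨0, 0, 1⟩).t) *ᵥ planeMap ψ ξ := by
  have h := ξ_map ψ (g := ⟨0, 0, t⟩ * ⟨0, ξ, 0⟩ * (⟨0, 0, t⟩)⁻¹) (by simp)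
  have h0 : (ψ ⟨0, ξ, 0⟩).t = 0 := t_map_eq_zero ψ.toMulEquiv rfl
  rw [ξ_conj _ rfl, map_mul, map_mul, map_inv, ξ_conj _ h0, t_map ψ ⟨0, 0, t⟩, ξ_map ψ rfl] at h
  exact h.symm

end Osc

/-! ### Uniqueness of the admissible triple. -/

namespace LatticeData

open Osc

theorem mem_halfDomain (d : LatticeData) : (d.x, d.y) ∈ halfDomain := by
  have h3 : Real.sqrt 3 ^ 2 = 3 := Real.sq_sqrt (by norm_num)
  obtain ⟨l, k, -, ⟨-, h⟩ | ⟨-, h⟩ | ⟨-, h⟩⟩ := d.admissible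
  · rw [h]
    refine ⟨by norm_num, by norm_num, by positivity, ?_⟩
    simp only [div_pow, h3]
    norm_num
  · rw [h]
    exact ⟨by norm_num, by norm_num, by norm_num, by norm_num⟩
  · exact h

variable {d₁ d₂ : LatticeData}

theorem exists_int_map_center (ψ : Osc d₁.param ≃ₜ* Osc d₂.param) {L : Subgroup (Osc d₁.param)}
    (h₁ : IsNormalized L)
    (h₂ : IsNormalized (L.map (ψ.toMulEquiv : Osc d₁.param →* Osc d₂.param))) :
    (∀ g ∈ Gam d₁.param, ψ g ∈ Gam d₂.param) ∧
      ∃ k : ℤ, ψ ⟨1, 0, 0⟩ = ⟨k, 0, 0⟩ := by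
  have hΓ : ∀ g ∈ Gam d₁.param, ψ g ∈ Gam d₂.param := by
    intro g hg
    rw [← h₁.1] at hg
    rw [← h₂.1]
    exact ⟨⟨g, hg.1, rfl⟩, t_map_eq_zero ψ.toMulEquiv hg.2⟩
  refine ⟨hΓ, ?_⟩
  obtain ⟨m, n, k, h⟩ := (mem_Gam_iff _ _).1 (hΓ ⟨1, 0, 0⟩ (Subgroup.subset_closure (by simp)))
  have h0 : (ψ ⟨1, 0, 0⟩).ξ = 0 := ξ_map_eq_zero ψ.toMulEquiv rfl rfl
  rw [h] at h0
  have hm : (m : ℝ) = 0 := by simpa using congrFun h0 0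
  have hn : (n : ℝ) = 0 := by simpa using congrFun h0 1
  refine ⟨k, ?_⟩
  rw [h, hm, hn]
  ext1
  · simp
  · ext i
    fin_cases i <;> simp
  · rfl

/-- An isomorphism between standard oscillator groups matching normalized lattices is given on `ℝ²`
by an integral matrix. -/
theorem exists_int_matrix (ψ : Osc d₁.param ≃ₜ* Osc d₂.param) {L : Subgroup (Osc d₁.param)}
    (h₁ : IsNormalized L)
    (h₂ : IsNormalized (L.map (ψ.toMulEquiv : Osc d₁.param →* Osc d₂.param))) :
    ∃ (p q s u k : ℤ) (c : ℝ), k * k = 1 ∧ c * c = 1 ∧ d₂.r * (p * u - q * s) = k * d₁.r ∧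
      ∀ t m n a b : ℝ, d₁.param.flow t *ᵥ ![m, n] = ![a, b] →
        d₂.param.flow (t * c) *ᵥ ![p * m + q * n, s * m + u * n] =
          ![p * a + q * b, s * a + u * b] := by
  obtain ⟨hΓ, k, hk⟩ := exists_int_map_center ψ h₁ h₂
  obtain ⟨-, k', hk'⟩ := exists_int_map_center ψ.symm h₂ (by rwa [map_map_symm])
  have hpow : ∀ (d : LatticeData) (a : ℝ) (n : ℤ),
      (⟨a, 0, 0⟩ : Osc d.param) ^ n = ⟨n * a, 0, 0⟩ := by
    intro d a n
    rw [zpow_mk, smul_zero]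
  have hkk : k * k' = 1 := by
    have h3 : (⟨k, 0, 0⟩ : Osc d₂.param) = ⟨1, 0, 0⟩ ^ k := by rw [hpow, mul_one]
    have h4 := congrArg ψ.symm hk
    rw [ψ.symm_apply_apply, h3, map_zpow, hk', hpow] at h4
    have h5 := congrArg Osc.z h4
    simp only at h5
    exact_mod_cast h5.symm
  have hk1 : k * k = 1 := by
    rcases Int.eq_one_or_neg_one_of_mul_eq_one hkk with h | h <;> rw [h] <;> rfl
  have hc : (ψ ⟨0, 0, 1⟩).t * (ψ ⟨0, 0, 1⟩).t = 1 := by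
    set c := (ψ ⟨0, 0, 1⟩).t with hcdef
    obtain ⟨g, hg, hg1⟩ : (1 : ℝ) ∈ Osc.t '' (L : Set (Osc d₁.param)) := by
      rw [h₁.2]
      exact ⟨1, by simp⟩
    obtain ⟨m, hm⟩ : (ψ g).t ∈ Set.range (fun m : ℤ => (m : ℝ)) := by
      rw [← h₂.2]
      exact ⟨ψ g, ⟨g, hg, rfl⟩, rfl⟩
    obtain ⟨_, ⟨g', hg', rfl⟩, hg1'⟩ : (1 : ℝ) ∈ Osc.t ''
        ((L.map (ψ.toMulEquiv : Osc d₁.param →* Osc d₂.param)) : Set (Osc d₂.param)) := by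
      rw [h₂.2]
      exact ⟨1, by simp⟩
    obtain ⟨m', hm'⟩ : g'.t ∈ Set.range (fun m : ℤ => (m : ℝ)) := by
      rw [← h₁.2]
      exact ⟨g', hg', rfl⟩
    have e1 := t_map ψ g
    rw [hg1, one_mul, ← hcdef] at e1
    simp only at hm hm'
    rw [e1] at hm
    have e2 := (t_map ψ g').symm.trans hg1'
    rw [← hcdef, ← hm, ← hm'] at e2
    have e3 : m' * m = 1 := by exact_mod_cast e2
    rw [← hm]
    rcases Int.eq_one_or_neg_one_of_mul_eq_one (mul_comm m' m ▸ e3) with h | h <;> rw [h] <;> simp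
  obtain ⟨p, s, z, h3⟩ := (mem_Gam_iff _ _).1
    (hΓ ⟨0, Pi.single 0 1, 0⟩ (Subgroup.subset_closure (by simp)))
  obtain ⟨q, u, w, h4⟩ := (mem_Gam_iff _ _).1
    (hΓ ⟨0, Pi.single 1 1, 0⟩ (Subgroup.subset_closure (by simp)))
  have hS0 : planeMap ψ (Pi.single 0 1) = ![(p : ℝ), s] := by
    have := ξ_map ψ (g := ⟨0, Pi.single 0 1, 0⟩) rfl
    rw [← this, h3]
  have hS1 : planeMap ψ (Pi.single 1 1) = ![(q : ℝ), u] := by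
    have := ξ_map ψ (g := ⟨0, Pi.single 1 1, 0⟩) rfl
    rw [← this, h4]
  have hS : ∀ a b : ℝ, planeMap ψ ![a, b] = ![p * a + q * b, s * a + u * b] := by
    intro a b
    have : ![a, b] = a • (Pi.single 0 1 : Fin 2 → ℝ) + b • (Pi.single 1 1 : Fin 2 → ℝ) := by
      ext i
      fin_cases i <;> simp
    rw [this, map_add, map_smul, map_smul, hS0, hS1]
    ext i
    fin_cases i <;> simp <;> ring
  refine ⟨p, q, s, u, k, (ψ ⟨0, 0, 1⟩).t, hk1, hc, ?_, ?_⟩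
  -- The image of the commutator of the two generators, computed twice: as the r₁-th power of the
  -- image of the central generator, and as r₂ times the determinant.
  · have h5 := commutator_eq (P := d₁.param) (α := ⟨0, Pi.single 0 1, 0⟩)
      (β := ⟨0, Pi.single 1 1, 0⟩) rfl rfl
    have h6 := congrArg ψ h5
    have h7 : (⟨d₁.param.ω (Pi.single 0 1) (Pi.single 1 1), 0, 0⟩ : Osc d₁.param)
        = ⟨1, 0, 0⟩ ^ (d₁.r : ℤ) := by
      rw [hpow, param_ω]
      simp
    rw [map_mul, map_mul, map_mul, map_inv, map_inv, h3, h4, commutator_eq rfl rfl, h7, map_zpow,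
      hk, hpow, param_ω] at h6
    have h8 := congrArg Osc.z h6
    simp at h8
    have h9 : (d₂.r : ℤ) * (p * u - s * q) = d₁.r * k := by exact_mod_cast h8
    linarith
  · intro t m n a b h
    rw [← hS, ← planeMap_flow, h, hS]

end LatticeData

/-- The right side is |m + n(-x + iy)|² = m² - 2xmn + n²(x² + y²). Since 0 ≤ 2x ≤ 1 and the integer
m² - |mn| + n² is positive, it is at least 1 + n²(x² + y² - 1). -/
theorem le_normSq_of_mem_halfDomain {x y : ℝ} (h : (x, y) ∈ halfDomain) (m : ℤ) {n : ℤ}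
    (hn : n ≠ 0) : x ^ 2 + y ^ 2 ≤ (m - x * n) ^ 2 + y ^ 2 * n ^ 2 := by
  obtain ⟨hx0, hx1, -, h1⟩ := h
  simp only at hx0 hx1 h1
  have hn2 : 1 ≤ (n : ℝ) ^ 2 := by
    have h2 : 0 < n ^ 2 := sq_pos_of_ne_zero hn
    have h3 : 1 ≤ n ^ 2 := by omega
    exact_mod_cast h3
  have hK : (1 : ℝ) ≤ m ^ 2 - |(m : ℝ) * n| + n ^ 2 := by
    have h2 : 0 < m ^ 2 - |m * n| + n ^ 2 := by
      have h3 : 0 < n ^ 2 := sq_pos_of_ne_zero hn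
      rcases abs_choice (m * n) with h | h <;> rw [h] <;>
        nlinarith [sq_nonneg (2 * m - n), sq_nonneg (2 * m + n)]
    have h4 : 1 ≤ m ^ 2 - |m * n| + n ^ 2 := by omega
    exact_mod_cast h4
  have hxm : 2 * x * (m * n) ≤ |(m : ℝ) * n| := by
    have h5 : 2 * x * ((m : ℝ) * n) ≤ 2 * x * |(m : ℝ) * n| := by
      gcongr
      exact le_abs_self _
    nlinarith [abs_nonneg ((m : ℝ) * n)]
  nlinarith [mul_le_mul_of_nonneg_right h1 (sub_nonneg.2 hn2)]

theorem one_le_normSq_of_mem_halfDomain {x y : ℝ} (h : (x, y) ∈ halfDomain) {m n : ℤ}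
    (hmn : m ≠ 0 ∨ n ≠ 0) : 1 ≤ (m - x * n) ^ 2 + y ^ 2 * n ^ 2 := by
  by_cases hn : n = 0
  · have hm : m ≠ 0 := hmn.resolve_right (not_not.2 hn)
    have h2 : 0 < m ^ 2 := sq_pos_of_ne_zero hm
    have h3 : 1 ≤ m ^ 2 := by omega
    have h4 : (1 : ℝ) ≤ (m : ℝ) ^ 2 := by exact_mod_cast h3
    simpa [hn] using h4
  · exact h.2.2.2.trans (le_normSq_of_mem_halfDomain h m hn)

namespace LatticeData

open Osc

variable {d₁ d₂ : LatticeData}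

/-- Divisibility comes from the determinant relation. At time 2π/λ₁ the source flow is trivial, so
the target rotation fixes the nonzero vector (p, s) and its angle lies in 2πℤ: up to sign, λ₂ is a
nonzero integer multiple of λ₁. -/
theorem r_dvd_and_lam_le (ψ : Osc d₁.param ≃ₜ* Osc d₂.param) {L : Subgroup (Osc d₁.param)}
    (h₁ : IsNormalized L)
    (h₂ : IsNormalized (L.map (ψ.toMulEquiv : Osc d₁.param →* Osc d₂.param))) :
    d₂.r ∣ d₁.r ∧ d₁.lam ≤ d₂.lam := by
  obtain ⟨p, q, s, u, k, c, hk, hc, hdet, hflow⟩ := exists_int_matrix ψ h₁ h₂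
  have hl1 := d₁.lam_pos
  have hl2 := d₂.lam_pos
  constructor
  · have : (d₂.r : ℤ) ∣ d₁.r := ⟨k * (p * u - q * s), by linear_combination -d₁.r * hk - k * hdet⟩
    exact_mod_cast this
  · have hps : ¬ (p = 0 ∧ s = 0) := by
      rintro ⟨rfl, rfl⟩
      have h0 : k * (d₁.r : ℤ) = 0 := by rw [← hdet]; ring
      have hr := d₁.r_pos
      rcases mul_eq_zero.1 h0 with h | h
      · rw [h] at hk
        simp at hk
      · omega
    have h1 := hflow (2 * Real.pi / d₁.lam) 1 0 1 0 (by
      rw [param_flow, mul_div_cancel₀ _ hl1.ne', Real.cos_two_pi, Real.sin_two_pi]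
      simp)
    have h2 := congrArg d₂.chart.C h1
    rw [d₂.chart.flow_apply, chart_lam, mul_eq_right₀] at h2
    · obtain ⟨n, hn⟩ := Complex.exp_eq_one_iff.1 h2
      have h3 : d₂.lam * (2 * Real.pi / d₁.lam * c) = n * (2 * Real.pi) := by
        have := congrArg Complex.im hn
        simpa using this
      have hπ := Real.pi_pos
      have h4 : d₂.lam * c = n * d₁.lam := by
        field_simp at h3
        linear_combination h3
      have hn0 : n ≠ 0 := by
        rintro rfl
        have hc0 : c ≠ 0 := by
          rintro rfl
          simp at hc
        simp [hc0, hl2.ne'] at h4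
      have h5 : 1 ≤ (n : ℝ) ^ 2 := by
        have h6 : 0 < n ^ 2 := sq_pos_of_ne_zero hn0
        have h7 : 1 ≤ n ^ 2 := by omega
        exact_mod_cast h7
      have h8 : d₂.lam ^ 2 = n ^ 2 * d₁.lam ^ 2 := by
        linear_combination (d₂.lam * c + n * d₁.lam) * h4 - d₂.lam ^ 2 * hc
      exact le_of_sq_le_sq (by nlinarith [sq_nonneg d₁.lam]) hl2.le
    · rw [Ne, LinearEquiv.map_eq_zero_iff]
      intro h
      apply hps
      have e0 := congrFun h 0
      have e1 := congrFun h 1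
      simp at e0 e1
      exact ⟨e0, e1⟩

/-- With equal r and λ, the integral matrix respects the forms Q(m, n) = (m - xn)² + y²n² up to the
factor y₂/y₁. Minima of Q₂ on integer vectors, compared with Q₁(e₁) = 1 and Q₁(e₂) = x₁² + y₁², give
the inequalities. -/
theorem y_le_and_normSq_le (ψ : Osc d₁.param ≃ₜ* Osc d₂.param) {L : Subgroup (Osc d₁.param)}
    (h₁ : IsNormalized L)
    (h₂ : IsNormalized (L.map (ψ.toMulEquiv : Osc d₁.param →* Osc d₂.param)))
    (hr : d₁.r = d₂.r) (hlam : d₁.lam = d₂.lam) :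
    d₁.y ≤ d₂.y ∧ (d₁.y = d₂.y → d₂.x ^ 2 + d₂.y ^ 2 ≤ d₁.x ^ 2 + d₁.y ^ 2) := by
  obtain ⟨p, q, s, u, k, c, hk, hc, hdet, hflow⟩ := exists_int_matrix ψ h₁ h₂
  have hl1 := d₁.lam_pos
  have hy1 := d₁.y_pos
  have hy2 := d₂.y_pos
  have hD : p * u - q * s = k := by
    have h0 : (d₂.r : ℤ) ≠ 0 := by exact_mod_cast d₂.r_pos.ne'
    rw [hr, mul_comm k] at hdet
    exact mul_left_cancel₀ h0 hdet
  have hDR : (p * u - q * s : ℝ) = k := by exact_mod_cast hD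
  have hkR : (k : ℝ) * k = 1 := by exact_mod_cast hk
  -- At a quarter period the flows are B₁ and cB₂, and Q(v) is y times the area spanned by v and Bv;
  -- the matrix multiplies areas by k.
  have key : ∀ m n : ℝ,
      d₁.y * ((p * m + q * n - d₂.x * (s * m + u * n)) ^ 2 + d₂.y ^ 2 * (s * m + u * n) ^ 2)
        = c * k * (d₂.y * ((m - d₁.x * n) ^ 2 + d₁.y ^ 2 * n ^ 2)) := by
    intro m n
    have hB : ∀ d : LatticeData, ∀ m n : ℝ, Bxy d.x d.y *ᵥ ![m, n] =
        ![d.x / d.y * m + (-d.x ^ 2 / d.y - d.y) * n, 1 / d.y * m + -d.x / d.y * n] := by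
      intro d m n
      ext i
      fin_cases i <;> simp [Bxy, Matrix.mulVec, dotProduct, Fin.sum_univ_two]
    have h1 := hflow (Real.pi / 2 / d₁.lam) m n _ _ (by
      rw [param_flow, mul_div_cancel₀ _ hl1.ne', Real.cos_pi_div_two, Real.sin_pi_div_two,
        zero_smul, one_smul, zero_add, hB])
    have h2 : d₂.param.flow (Real.pi / 2 / d₁.lam * c) = c • Bxy d₂.x d₂.y := by
      have e : d₂.lam * (Real.pi / 2 / d₁.lam * c) = c * (Real.pi / 2) := by
        rw [← hlam]
        field_simp
      rw [param_flow, e]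
      rcases mul_self_eq_one_iff.1 hc with h | h <;> rw [h] <;> simp
    rw [h2, Matrix.smul_mulVec, hB] at h1
    have hQ : ∀ (d : LatticeData) (m n : ℝ), d.y * (m * (1 / d.y * m + -d.x / d.y * n)
        - n * (d.x / d.y * m + (-d.x ^ 2 / d.y - d.y) * n))
          = (m - d.x * n) ^ 2 + d.y ^ 2 * n ^ 2 := by
      intro d m n
      have := d.y_pos
      field_simp
      ring
    rw [← hQ d₁, ← hQ d₂]
    generalize d₁.x / d₁.y * m + (-d₁.x ^ 2 / d₁.y - d₁.y) * n = a₁ at h1 ⊢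
    generalize 1 / d₁.y * m + -d₁.x / d₁.y * n = b₁ at h1 ⊢
    set X := p * m + q * n with hX
    set Y := s * m + u * n with hY
    generalize d₂.x / d₂.y * X + (-d₂.x ^ 2 / d₂.y - d₂.y) * Y = a₂ at h1 ⊢
    generalize 1 / d₂.y * X + -d₂.x / d₂.y * Y = b₂ at h1 ⊢
    have e0 : c * a₂ = p * a₁ + q * b₁ := congrFun h1 0
    have e1 : c * b₂ = s * a₁ + u * b₁ := congrFun h1 1
    have e2 : X * b₂ - Y * a₂ = c * k * (m * b₁ - n * a₁) := by
      rw [← hDR]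
      linear_combination c * X * e1 - c * Y * e0 - (X * b₂ - Y * a₂) * hc
        + c * (s * a₁ + u * b₁) * hX - c * (p * a₁ + q * b₁) * hY
    linear_combination d₁.y * d₂.y * e2
  -- Both forms are positive, so reversal of time and reversal of orientation can only occur
  -- together.
  have hck : c * k = 1 := by
    have h1 : (c * k) * (c * k) = 1 := by linear_combination k * k * hc + hkR
    rcases mul_self_eq_one_iff.1 h1 with h | h
    · exact h
    · exfalso
      have h2 := key 1 0
      rw [h] at h2
      have h3 : 0 < d₂.y * ((1 - d₁.x * 0) ^ 2 + d₁.y ^ 2 * 0 ^ 2) := by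
        norm_num
        exact hy2
      have h4 : 0 ≤ d₁.y * ((p * 1 + q * 0 - d₂.x * (s * 1 + u * 0)) ^ 2
        + d₂.y ^ 2 * (s * 1 + u * 0) ^ 2) := by positivity
      linarith
  have hk0 : k ≠ 0 := by
    rintro rfl
    simp at hk
  have k1 := key 1 0
  have k2 := key 0 1
  rw [hck] at k1 k2
  simp at k1 k2
  have hps : p ≠ 0 ∨ s ≠ 0 := by
    by_contra h
    push Not at h
    apply hk0
    rw [← hD, h.1, h.2]
    ring
  have hsu : s ≠ 0 ∨ u ≠ 0 := by
    by_contra h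
    push Not at h
    apply hk0
    rw [← hD, h.1, h.2]
    ring
  have hd1 := d₁.mem_halfDomain.2.2.2
  simp only at hd1
  constructor
  · rw [← k1]
    exact le_mul_of_one_le_right hy1.le (one_le_normSq_of_mem_halfDomain d₂.mem_halfDomain hps)
  · intro hy
    rw [hy] at k1 k2 hd1
    have k1' := mul_left_cancel₀ hy2.ne' (k1.trans (mul_one _).symm)
    have k2' := mul_left_cancel₀ hy2.ne' k2
    rw [hy]
    -- Whichever image of e₁, e₂ has nonzero second coordinate has Q₂ at least x₂² + y₂². For the
    -- image of e₁ that value is 1, itself at most x₁² + y₁².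
    rcases hsu with h | h
    · have := le_normSq_of_mem_halfDomain d₂.mem_halfDomain p h
      linarith
    · have := le_normSq_of_mem_halfDomain d₂.mem_halfDomain q h
      linarith

theorem eq_of_normalized (ψ : Osc d₁.param ≃ₜ* Osc d₂.param) {L : Subgroup (Osc d₁.param)}
    (h₁ : IsNormalized L)
    (h₂ : IsNormalized (L.map (ψ.toMulEquiv : Osc d₁.param →* Osc d₂.param))) : d₁ = d₂ := by
  have hsymm : (L.map (ψ.toMulEquiv : Osc d₁.param →* Osc d₂.param)).map
      (ψ.symm.toMulEquiv : Osc d₂.param →* Osc d₁.param) = L := map_map_symm ψ L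
  have h₁' := h₁
  rw [← hsymm] at h₁'
  obtain ⟨hr, hl⟩ := r_dvd_and_lam_le ψ h₁ h₂
  obtain ⟨hr', hl'⟩ := r_dvd_and_lam_le ψ.symm h₂ h₁'
  have hre := Nat.dvd_antisymm hr' hr
  have hle := le_antisymm hl hl'
  obtain ⟨hy, hx⟩ := y_le_and_normSq_le ψ h₁ h₂ hre hle
  obtain ⟨hy', hx'⟩ := y_le_and_normSq_le ψ.symm h₂ h₁' hre.symm hle.symm
  have hye := le_antisymm hy hy'
  have hxe : d₁.x = d₂.x := by
    have e1 := hx hye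
    have e2 := hx' hye.symm
    have p1 := d₁.mem_halfDomain.1
    have p2 := d₂.mem_halfDomain.1
    simp only at p1 p2
    rw [hye] at e1 e2
    exact (sq_eq_sq₀ p1 p2).1 (by linarith)
  obtain ⟨r, l, x, y, _, _⟩ := d₁
  obtain ⟨r', l', x', y', _, _⟩ := d₂
  simp only at hre hle hye hxe
  subst hre hle hye hxe
  rfl

end LatticeData

theorem mainTheorem3 :
    (∀ (P : OscParam) (L : Subgroup (Osc P)), Osc.IsLattice L →
      ∃! d : LatticeData, ∃ φ : Osc P ≃ₜ* Osc d.param,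
        Osc.IsNormalized (L.map (φ.toMulEquiv : Osc P →* Osc d.param))) ∧
    (∀ d : LatticeData, ∃ L : Subgroup (Osc d.param),
      Osc.IsLattice L ∧ Osc.IsNormalized L) := by
  refine ⟨fun P L hL => ?_, fun d => d.exists_normalized_lattice⟩
  obtain ⟨d, φ, hφ⟩ := Osc.exists_normalizing_iso hL
  refine ⟨d, ⟨φ, hφ⟩, ?_⟩
  rintro d' ⟨φ', hφ'⟩
  refine (LatticeData.eq_of_normalized (φ.symm.trans φ') hφ ?_).symm
  convert hφ' using 1
  rw [Subgroup.map_map]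
  congr 1
  ext g : 1
  exact congrArg φ' (φ.symm_apply_apply g)
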